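/- Let $k\ge 1$ be an integer. A $k$-sorted relation on $\{0,1\}$ of arity $n\ge 0$ is a subset of $\{0,1\}^n$ together with a sort in $\{1,\dots,k\}$ for each of its $n$ variables. For a set $S$ of $k$-sorted relations, let $[S]$ be the set of all $k$-sorted relations on $\{0,1\}$ definable by a first-order formula built with conjunction, existential and universal quantification over sorted variables from atomic formulas that use the relations in $S$, the nullary relation "false", and the equality relation on each sort, where every variable has one fixed sort and is substituted only in places of that sort. A $k$-sorted quantified relational clone is a set $S$ with $[S]=S$. Let $CR^k_{1-6}$ be the set of all $k$-sorted relations which, up to the order of their variables, have one of the following forms (arithmetic modulo $2$, distinct letters denote distinct variables, superscripts are sorts, $i,j\in\{1,\dots,k\}$, $b\in\{0,1\}$): (c1) $x^i=0\lor y^i=1$; (c2) $x^i=y^i\lor u^j=b$; (c3) $x^i=y^i\lor u^j=v^j$ with $i\ne j$, or $x^i=y^i\lor y^i=z^i$; (c4) $x^i+y^i=1$; (c5) $x^i+y^i=u^j+v^j$; (c6) $x^{s_1}+\dots+x^{s_n}=b$ with $n\ge 2$ and $s_1,\dots,s_n$ pairwise distinct. A relation is of type (c7) if it is a (possibly empty)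 disjunction of equations $x=b_s$, one for each of its variables $x$, where $s$ is the sort of $x$ and the constant $b_s\in\{0,1\}$ depends only on $s$. Encode it by the tuple $\mu(\rho)=(m_1,n_1,\dots,m_k,n_k)\in\mathbb N_0^{2k}$, where $m_i$ and $n_i$ are the numbers of equations $x=0$ and $x=1$, respectively, with $x$ of sort $i$ in this disjunction. Theorem. The set $CR^k_{1-6}$ is finite, and the poset of $k$-sorted quantified relational clones on $\{0,1\}$, ordered by inclusion, embeds into $$(2^{CR^k_{1-6}},\subseteq)\times(\{\text{downsets of }(\mathbb N_0^{2k},\preceq)\},\subseteq),$$ where $\preceq$ is the coordinatewise order. More precisely, the map $$S\mapsto\bigl(S\cap CR^k_{1-6},\ \{\mu(\rho) : \rho\in S\text{ of type (c7)}\}\bigr)$$ takes values in this product and is an order embedding: $S\subseteq S'$ if and only if the image of $S$ is less than or equal to the image of $S'$ (in particular it is injective). -/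

import Mathlib

/-- A `k`-sorted relation (predicate) on `A`: an arity `n ≥ 0`, a sort for each of the `n`
variables, and a set of `n`-tuples of elements of `A`. -/
structure SortedRel (A : Type) (k : ℕ) where
  arity : ℕ
  sort : Fin arity → Fin k
  carrier : Set (Fin arity → A)

namespace SortedRel

/-- Two relations are similar if they differ only by the order of their variables. -/
def Similar {A : Type} {k : ℕ} (ρ σ : SortedRel A k) : Prop :=
  ∃ e : Fin ρ.arity ≃ Fin σ.arity,
    (∀ i, σ.sort (e i) = ρ.sort i) ∧
      ∀ x : Fin σ.arity → A, x ∈ σ.carrier ↔ (fun i => x (e i)) ∈ ρ.carrier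

/-- The nullary relation that is false. -/
def falsum (A : Type) (k : ℕ) : SortedRel A k := ⟨0, Fin.elim0, ∅⟩

/-- The equality relation between two variables of sort `i`. -/
def equality (A : Type) {k : ℕ} (i : Fin k) : SortedRel A k := ⟨2, ![i, i], {x | x 0 = x 1}⟩

end SortedRel

/-- Sorted quantified primitive positive formulas over `S`. The indices `n` and `s` are the number
and the sorts of the variables in scope, that is, of the possible free variables. An atomic formula
substitutes variables in scope into a relation of `S`, the false nullary relation or an equality
relation, and each variable must have the sort of the place into which it is substituted.
A quantifier binds a new variable of some sort `i`, which is placed in front of the others. -/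
inductive QppFormula {A : Type} {k : ℕ} (S : Set (SortedRel A k)) :
    (n : ℕ) → (Fin n → Fin k) → Type
  | atom {n : ℕ} {s : Fin n → Fin k} (ρ : SortedRel A k)
      (hρ : ρ ∈ S ∪ {SortedRel.falsum A k} ∪ Set.range (SortedRel.equality A))
      (v : Fin ρ.arity → Fin n) (hv : ∀ j, s (v j) = ρ.sort j) : QppFormula S n s
  | conj {n : ℕ} {s : Fin n → Fin k} (φ ψ : QppFormula S n s) : QppFormula S n s
  | exist {n : ℕ} {s : Fin n → Fin k} (i : Fin k)
      (φ : QppFormula S (n + 1) (Fin.cons (α := fun _ => Fin k) i s)) : QppFormula S n s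
  | univ {n : ℕ} {s : Fin n → Fin k} (i : Fin k)
      (φ : QppFormula S (n + 1) (Fin.cons (α := fun _ => Fin k) i s)) : QppFormula S n s

/-- Satisfaction of a formula by an assignment of values to the variables in scope. -/
def QppFormula.Holds {A : Type} {k : ℕ} {S : Set (SortedRel A k)} :
    {n : ℕ} → {s : Fin n → Fin k} → QppFormula S n s → (Fin n → A) → Prop
  | _, _, .atom ρ _ v _, x => (fun j => x (v j)) ∈ ρ.carrier
  | _, _, .conj φ ψ, x => φ.Holds x ∧ ψ.Holds x
  | _, _, .exist _ φ, x => ∃ a : A, φ.Holds (Fin.cons (α := fun _ => A) a x)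
  | _, _, .univ _ φ, x => ∀ a : A, φ.Holds (Fin.cons (α := fun _ => A) a x)

/-- The set of all relations defined from `S` by sorted quantified primitive positive formulas. -/
def qppClosure {A : Type} {k : ℕ} (S : Set (SortedRel A k)) : Set (SortedRel A k) :=
  {ρ | ∃ φ : QppFormula S ρ.arity ρ.sort, ∀ x, x ∈ ρ.carrier ↔ φ.Holds x}

/-- The `k`-sorted quantified relational clones on `{0, 1}`, as a type; as a subtype of a type of
sets it is ordered by inclusion. -/
abbrev QuantRelClone (k : ℕ) : Type :=
  {S : Set (SortedRel (ZMod 2) k) // qppClosure S = S}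

namespace Canonical

/-! The canonical relations on `{0, 1}`. Arithmetic is modulo two, and the variables
`x 0, x 1, …` are distinct. None of these relations has a dummy variable. -/

/-- `x = 0 ∨ y = 1`, both variables of sort `i`. -/
def c1 {k : ℕ} (i : Fin k) : SortedRel (ZMod 2) k :=
  ⟨2, ![i, i], {x | x 0 = 0 ∨ x 1 = 1}⟩

/-- `x = y ∨ u = b`, with `x, y` of sort `i` and `u` of sort `j`. -/
def c2 {k : ℕ} (i j : Fin k) (b : ZMod 2) : SortedRel (ZMod 2) k :=
  ⟨3, ![i, i, j], {x | x 0 = x 1 ∨ x 2 = b}⟩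

/-- `x = y ∨ u = v`, with `x, y` of sort `i` and `u, v` of sort `j` (canonical for `i ≠ j`). -/
def c3 {k : ℕ} (i j : Fin k) : SortedRel (ZMod 2) k :=
  ⟨4, ![i, i, j, j], {x | x 0 = x 1 ∨ x 2 = x 3}⟩

/-- `x = y ∨ y = z`, all variables of sort `i`. -/
def c3' {k : ℕ} (i : Fin k) : SortedRel (ZMod 2) k :=
  ⟨3, ![i, i, i], {x | x 0 = x 1 ∨ x 1 = x 2}⟩

/-- `x + y = 1`, both variables of sort `i`. -/
def c4 {k : ℕ} (i : Fin k) : SortedRel (ZMod 2) k :=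
  ⟨2, ![i, i], {x | x 0 + x 1 = 1}⟩

/-- `x + y = u + v`, with `x, y` of sort `i` and `u, v` of sort `j`. -/
def c5 {k : ℕ} (i j : Fin k) : SortedRel (ZMod 2) k :=
  ⟨4, ![i, i, j, j], {x | x 0 + x 1 = x 2 + x 3}⟩

/-- `x 0 + ⋯ + x (n - 1) = b`, with `x p` of sort `s p` (canonical for `2 ≤ n` and `s`
injective). -/
def c6 {k n : ℕ} (s : Fin n → Fin k) (b : ZMod 2) : SortedRel (ZMod 2) k :=
  ⟨n, s, {x | ∑ p, x p = b}⟩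

/-- The disjunction of the equations `x p = b (t p)`, where `t p` is the sort of `x p`: all
variables of the same sort are compared with the same constant. Any number of variables of each
sort is allowed; the empty disjunction is the false nullary relation. -/
def c7 {k n : ℕ} (t : Fin n → Fin k) (b : Fin k → ZMod 2) : SortedRel (ZMod 2) k :=
  ⟨n, t, {x | ∃ p, x p = b (t p)}⟩

/-- The relations that have one of the first six canonical forms. -/
inductive IsBasicOneSix {k : ℕ} : SortedRel (ZMod 2) k → Prop
  | c1 (i : Fin k) : IsBasicOneSix (c1 i)
  | c2 (i j : Fin k) (b : ZMod 2) : IsBasicOneSix (c2 i j b)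
  | c3 (i j : Fin k) (hij : i ≠ j) : IsBasicOneSix (c3 i j)
  | c3' (i : Fin k) : IsBasicOneSix (c3' i)
  | c4 (i : Fin k) : IsBasicOneSix (c4 i)
  | c5 (i j : Fin k) : IsBasicOneSix (c5 i j)
  | c6 {n : ℕ} (hn : 2 ≤ n) (s : Fin n → Fin k) (hs : Function.Injective s) (b : ZMod 2) :
      IsBasicOneSix (c6 s b)

/-- The canonical relations of the first six types: those which up to the order of variables have
one of the first six forms. -/
def oneSix (k : ℕ) : Set (SortedRel (ZMod 2) k) :=
  {ρ | ∃ σ, IsBasicOneSix σ ∧ σ.Similar ρ}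

/-- The element of `ℕ^(2k)` that encodes `c7 t b`: the coordinate `(i, c)` is the number of
equations `x = c` with `x` of sort `i` in the disjunction. -/
def tuple {k n : ℕ} (t : Fin n → Fin k) (b : Fin k → ZMod 2) : Fin k × ZMod 2 → ℕ :=
  fun q => (Finset.univ.filter fun p : Fin n => t p = q.1 ∧ b (t p) = q.2).card

/-- The set of tuples that encode the canonical relations of the seventh type in `S`. (The family
`c7` is already closed under reordering of variables.) -/
def tuples {k : ℕ} (S : Set (SortedRel (ZMod 2) k)) : Set (Fin k × ZMod 2 → ℕ) :=
  {m | ∃ (n : ℕ) (t : Fin n → Fin k) (b : Fin k → ZMod 2), c7 t b ∈ S ∧ m = tuple t b}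

end Canonical

/-! The tuples of type (c7) in a clone form a downset because a universal quantifier deletes a
variable from a disjunction of equations (`rel_of_tuple_le`). The content is that a clone is
determined by its canonical members. By a Galois connection (`rel_of_forall_inv`) a clone consists
of the predicates preserved by its surjective polymorphisms, which are families of surjective
operations, one per sort. So it suffices to show that surjective operations `f` preserving the
canonical predicates of `D` preserve all of `D` (`le_inv_of_canonLE`).

Take a counterexample of minimal arity: rows in a predicate whose image `α` under `f` is not.
Enlarge the predicate to a maximal member `ρ` of `D` that avoids `α` (`Critical`). Minimality says
that predicates of `D` in fewer variables are preserved, so every one-coordinate flip of `α` lies in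
`ρ`. Maximality says that every weakening of `ρ` inside `D` that still avoids `α` equals `ρ`.
Moreover, the coordinates cannot be split into two nonempty parts linked by relations `C2`
(`false_of_C2`).

If `α` is the only point missing, `ρ` is a disjunction of equations: it has type (c7), or is `C1`,
or yields a `C2` splitting. Otherwise take a second missing point `β`, minimal above `α`. Slices of
`ρ` in two or three coordinates, taken in a larger clone with all constants, yield small canonical
relations; `exists_le_const` brings these back to `D`, up to replacement by `C3`. Where `β` differs
from `α` at a sort with `C3`, either there is a `C2` splitting or the operations are translates of
one projection and `ρ` is a linear equation (`false_of_C3`). Without such a sort, either there is a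
`C2` splitting or `ρ` is again linear (`false_of_not_C3`). Linear equations are excluded by
(c4)–(c7). -/

/-- A family of sorted predicates on `{0, 1}`, with variables indexed by arbitrary finite types,
closed under quantified primitive positive definitions. -/
structure QClone (k : ℕ) where
  rel : ∀ {ι : Type} [Finite ι], (ι → Fin k) → ((ι → ZMod 2) → Prop) → Prop
  bot : rel (Fin.elim0 : Fin 0 → Fin k) fun _ => False
  top : rel (Fin.elim0 : Fin 0 → Fin k) fun _ => True
  eq : ∀ i, rel (fun _ : Fin 2 => i) fun x => x 0 = x 1
  subst : ∀ {ι κ : Type} [Finite ι] [Finite κ] {s : ι → Fin k} {s' : κ → Fin k}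
    {P : (ι → ZMod 2) → Prop} (v : ι → κ), (∀ i, s' (v i) = s i) → rel s P →
      rel s' fun x => P fun i => x (v i)
  and : ∀ {ι : Type} [Finite ι] {s : ι → Fin k} {P Q : (ι → ZMod 2) → Prop},
    rel s P → rel s Q → rel s fun x => P x ∧ Q x
  ex : ∀ {ι : Type} [Finite ι] {s : ι → Fin k} (i : Fin k) {Q : ZMod 2 → (ι → ZMod 2) → Prop},
    rel (fun o : Option ι => o.elim i s) (fun y => Q (y none) fun t => y (some t)) →
      rel s fun x => ∃ a, Q a x
  all : ∀ {ι : Type} [Finite ι] {s : ι → Fin k} (i : Fin k) {Q : ZMod 2 → (ι → ZMod 2) → Prop},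
    rel (fun o : Option ι => o.elim i s) (fun y => Q (y none) fun t => y (some t)) →
      rel s fun x => ∀ a, Q a x

/-! ### Definability over arbitrary finite sets of variables -/

section Formula

variable {k : ℕ} {T : Set (SortedRel (ZMod 2) k)}

theorem QppFormula.exists_rename {n : ℕ} {s : Fin n → Fin k} (φ : QppFormula T n s) :
    ∀ {m : ℕ} {s' : Fin m → Fin k} (v : Fin n → Fin m), (∀ j, s' (v j) = s j) →
      ∃ ψ : QppFormula T m s', ∀ x, ψ.Holds x ↔ φ.Holds fun j => x (v j) := by
  induction φ with
  | atom ρ hρ w hw =>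
    intro m s' v hv
    exact ⟨.atom ρ hρ (fun j => v (w j)) fun j => (hv _).trans (hw j), fun x => Iff.rfl⟩
  | conj φ ψ ih₁ ih₂ =>
    intro m s' v hv
    obtain ⟨φ', h₁⟩ := ih₁ v hv
    obtain ⟨ψ', h₂⟩ := ih₂ v hv
    exact ⟨.conj φ' ψ', fun x => and_congr (h₁ x) (h₂ x)⟩
  | exist i φ ih =>
    intro m s' v hv
    obtain ⟨φ', h⟩ := ih (s' := Fin.cons (α := fun _ => Fin k) i s')
      (Fin.cons (α := fun _ => Fin (m + 1)) 0 fun j => (v j).succ)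
      (fun j => by cases j using Fin.cases <;> simp [hv])
    refine ⟨.exist i φ', fun x => exists_congr fun a => (h _).trans (iff_of_eq (congrArg _ ?_))⟩
    funext j
    cases j using Fin.cases <;> simp
  | univ i φ ih =>
    intro m s' v hv
    obtain ⟨φ', h⟩ := ih (s' := Fin.cons (α := fun _ => Fin k) i s')
      (Fin.cons (α := fun _ => Fin (m + 1)) 0 fun j => (v j).succ)
      (fun j => by cases j using Fin.cases <;> simp [hv])
    refine ⟨.univ i φ', fun x => forall_congr' fun a => (h _).trans (iff_of_eq (congrArg _ ?_))⟩
    funext j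
    cases j using Fin.cases <;> simp

/-- The predicate `P` is defined by a formula over `T`. -/
def IsQppDefinable (T : Set (SortedRel (ZMod 2) k)) {ι : Type} [Finite ι] (s : ι → Fin k)
    (P : (ι → ZMod 2) → Prop) : Prop :=
  ∃ φ : QppFormula T (Nat.card ι) fun j => s ((Finite.equivFin ι).symm j),
    ∀ x, φ.Holds x ↔ P fun i => x (Finite.equivFin ι i)

theorem IsQppDefinable.of_formula {ι : Type} [Finite ι] {s : ι → Fin k} {P : (ι → ZMod 2) → Prop}
    {n : ℕ} {t : Fin n → Fin k} (φ : QppFormula T n t) (v : Fin n → ι) (hv : ∀ j, s (v j) = t j)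
    (h : ∀ x : ι → ZMod 2, φ.Holds (fun j => x (v j)) ↔ P x) : IsQppDefinable T s P := by
  obtain ⟨ψ, hψ⟩ := φ.exists_rename (s' := fun j => s ((Finite.equivFin ι).symm j))
    (fun j => Finite.equivFin ι (v j)) (by simpa using hv)
  exact ⟨ψ, fun x => (hψ x).trans (h fun i => x (Finite.equivFin ι i))⟩

theorem IsQppDefinable.exists_formula {ι : Type} [Finite ι] {s : ι → Fin k}
    {P : (ι → ZMod 2) → Prop} (h : IsQppDefinable T s P) {n : ℕ} {t : Fin n → Fin k}
    (v : ι → Fin n) (hv : ∀ j, t (v j) = s j) :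
    ∃ φ : QppFormula T n t, ∀ x, φ.Holds x ↔ P fun i => x (v i) := by
  obtain ⟨φ, hφ⟩ := h
  obtain ⟨ψ, hψ⟩ := φ.exists_rename (s' := t) (fun j => v ((Finite.equivFin ι).symm j))
    (fun j => hv _)
  exact ⟨ψ, fun x => by simp [hψ, hφ]⟩

theorem IsQppDefinable.exists_formula_cons {ι : Type} [Finite ι] {s : ι → Fin k} {i : Fin k}
    {Q : ZMod 2 → (ι → ZMod 2) → Prop}
    (h : IsQppDefinable T (fun o : Option ι => o.elim i s)
      fun y => Q (y none) fun t => y (some t)) :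
    ∃ φ : QppFormula T (Nat.card ι + 1) (Fin.cons (α := fun _ => Fin k) i
        fun j => s ((Finite.equivFin ι).symm j)),
      ∀ a x, φ.Holds (Fin.cons (α := fun _ => ZMod 2) a x) ↔
        Q a fun t => x (Finite.equivFin ι t) := by
  obtain ⟨φ, hφ⟩ := h.exists_formula (t := Fin.cons (α := fun _ => Fin k) i
        fun j => s ((Finite.equivFin ι).symm j))
    (fun o => o.elim 0 fun t => (Finite.equivFin ι t).succ)
    (fun o => by cases o <;> simp)
  exact ⟨φ, fun a x => by simp [hφ]⟩

end Formula

/-! ### Generated clones and their duality with surjective polymorphisms -/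

namespace QClone

variable {k : ℕ}

/-- The predicates definable over `T`. -/
def gen (hk : 1 ≤ k) (T : Set (SortedRel (ZMod 2) k)) : QClone k where
  rel s P := IsQppDefinable T s P
  bot := .of_formula (.atom (SortedRel.falsum _ k) (by simp) Fin.elim0 fun j => Fin.elim0 j)
    (t := Fin.elim0) id (fun j => j.elim0) fun x => Iff.rfl
  top := .of_formula (t := Fin.elim0)
    -- Truth is expressed as `∃ x, x = x`, which requires at least one sort.
    (.exist ⟨0, hk⟩ (.atom (SortedRel.equality _ ⟨0, hk⟩) (by simp) (fun _ => 0)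
      fun j => by fin_cases j <;> rfl)) id (fun j => j.elim0) fun x => by
      simp only [QppFormula.Holds, SortedRel.equality, iff_true]
      exact ⟨0, rfl⟩
  eq i := .of_formula (t := fun _ : Fin 2 => i)
    (.atom (SortedRel.equality _ i) (by simp) id fun j => by
      change Fin 2 at j
      fin_cases j <;> rfl) id (fun j => rfl) fun x => Iff.rfl
  subst {ι κ _ _ s s' P} v hv h := by
    obtain ⟨φ, hφ⟩ := h
    exact .of_formula φ (fun j => v ((Finite.equivFin ι).symm j)) (fun j => hv _)
      fun x => by simp [hφ]
  and h₁ h₂ := by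
    obtain ⟨φ, hφ⟩ := h₁
    obtain ⟨ψ, hψ⟩ := h₂
    exact ⟨.conj φ ψ, fun x => and_congr (hφ x) (hψ x)⟩
  ex i _ h := by
    obtain ⟨φ, hφ⟩ := h.exists_formula_cons
    exact ⟨.exist i φ, fun x => exists_congr fun a => hφ a x⟩
  all i _ h := by
    obtain ⟨φ, hφ⟩ := h.exists_formula_cons
    exact ⟨.univ i φ, fun x => forall_congr' fun a => hφ a x⟩

theorem gen_rel_iff (hk : 1 ≤ k) {T : Set (SortedRel (ZMod 2) k)} (ρ : SortedRel (ZMod 2) k) :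
    (gen hk T).rel ρ.sort (· ∈ ρ.carrier) ↔ ρ ∈ qppClosure T := by
  constructor
  · intro h
    obtain ⟨φ, hφ⟩ := IsQppDefinable.exists_formula h (t := ρ.sort) id fun _ => rfl
    exact ⟨φ, fun x => (hφ x).symm⟩
  · rintro ⟨φ, hφ⟩
    exact .of_formula φ id (fun _ => rfl) fun x => (hφ x).symm

theorem gen_rel_fin_iff (hk : 1 ≤ k) {T : Set (SortedRel (ZMod 2) k)} {n : ℕ} (s : Fin n → Fin k)
    (P : (Fin n → ZMod 2) → Prop) :
    (gen hk T).rel s P ↔ (⟨n, s, {x | P x}⟩ : SortedRel (ZMod 2) k) ∈ qppClosure T :=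
  gen_rel_iff hk ⟨n, s, {x | P x}⟩

/-- The predicates of `D` are predicates of `E`. -/
instance : LE (QClone k) where
  le D E := ∀ {ι : Type} [Finite ι] {s : ι → Fin k} {P : (ι → ZMod 2) → Prop},
    D.rel s P → E.rel s P

/-- The predicates preserved by a family of surjective operations, one for each sort. -/
def inv {m : Type} [Nonempty m] (f : Fin k → (m → ZMod 2) → ZMod 2)
    (hf : ∀ i, Function.Surjective (f i)) : QClone k where
  rel {ι _} s P := ∀ M : m → ι → ZMod 2, (∀ t, P (M t)) → P fun p => f (s p) fun t => M t p
  bot M h := h (Classical.arbitrary m)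
  top _ _ := trivial
  eq i M h := congrArg (f i) (funext h)
  subst {ι κ _ _ s s' P} v hv h M hM := by
    have := h (fun t i => M t (v i)) hM
    simpa [hv] using this
  and h₁ h₂ M hM := ⟨h₁ M fun t => (hM t).1, h₂ M fun t => (hM t).2⟩
  ex {ι _ s} i Q h M hM := by
    choose a ha using hM
    exact ⟨f i a, h (fun t o => o.elim (a t) (M t)) ha⟩
  all {ι _ s} i Q h M hM a := by
    -- Surjectivity is what makes universal quantification compatible with the operations: the value
    -- `a` is itself an image.
    obtain ⟨v, rfl⟩ := hf i a
    exact h (fun t o => o.elim (v t) (M t)) fun t => hM t (v t)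

variable (D : QClone k) {ι : Type} [Finite ι] {s : ι → Fin k}

theorem bot' : D.rel s fun _ => False :=
  D.subst (s' := s) Fin.elim0 (fun i => i.elim0) D.bot

theorem top' : D.rel s fun _ => True :=
  D.subst (s' := s) Fin.elim0 (fun i => i.elim0) D.top

theorem eq' (p q : ι) (h : s p = s q) : D.rel s fun x => x p = x q :=
  D.subst (s' := s) ![p, q] (fun i => by fin_cases i <;> simp [h]) (D.eq (s q))

variable {D}

theorem rel_congr {P Q : (ι → ZMod 2) → Prop} (h : D.rel s P) (hPQ : ∀ x, P x ↔ Q x) : D.rel s Q := by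
  rwa [← funext fun x => propext (hPQ x)]

/-- There are only finitely many predicates on a finite set of variables, so arbitrary conjunctions
are finite ones. -/
theorem forall_mem (Ps : Set ((ι → ZMod 2) → Prop)) (h : ∀ P ∈ Ps, D.rel s P) :
    D.rel s fun x => ∀ P ∈ Ps, P x := by
  have hfin : Ps.Finite := Set.toFinite _
  induction Ps, hfin using Set.Finite.induction_on with
  | empty => simpa using D.top'
  | @insert P Ps _ _ ih =>
    refine rel_congr (D.and (h P (by simp)) (ih fun Q hQ => h Q (by simp [hQ]))) fun x => ?_
    simp

theorem iInter {J : Sort*} {P : J → (ι → ZMod 2) → Prop} (h : ∀ j, D.rel s (P j)) :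
    D.rel s fun x => ∀ j, P j x :=
  rel_congr (forall_mem (Set.range P) (by rintro _ ⟨j, rfl⟩; exact h j)) fun x => by simp

theorem ex_sum {κ : Type} [Finite κ] : ∀ {ι : Type} [Finite ι] {s : ι → Fin k} (s' : κ → Fin k)
    {Q : (ι → ZMod 2) → (κ → ZMod 2) → Prop},
    D.rel (Sum.elim s s') (fun w => Q (fun i => w (.inl i)) fun j => w (.inr j)) →
      D.rel s fun x => ∃ y, Q x y := by
  refine Finite.induction_empty_option (P := fun κ : Type => ∀ [Finite κ], ∀ {ι : Type} [Finite ι]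
    {s : ι → Fin k} (s' : κ → Fin k) {Q : (ι → ZMod 2) → (κ → ZMod 2) → Prop},
    D.rel (Sum.elim s s') (fun w => Q (fun i => w (.inl i)) fun j => w (.inr j)) →
      D.rel s fun x => ∃ y, Q x y) ?_ ?_ ?_ κ
  · intro α β e ih _ ι _ s s' Q h
    have : Finite α := Finite.of_equiv β e.symm
    refine rel_congr (ih (s := s) (fun a => s' (e a)) (Q := fun x y => Q x fun b => y (e.symm b)) ?_)
      fun x => ⟨fun ⟨y, hy⟩ => ⟨_, hy⟩, fun ⟨y, hy⟩ => ⟨fun a => y (e a), by simpa using hy⟩⟩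
    exact D.subst (s' := Sum.elim s fun a => s' (e a)) (Sum.map id e.symm)
      (by rintro (i | i) <;> simp) h
  · intro _ ι _ s s' Q h
    refine rel_congr (D.subst (s' := s) (Sum.elim id PEmpty.elim) (by rintro (i | i); rfl; cases i) h)
      fun x => ⟨fun h => ⟨_, h⟩, fun ⟨y, hy⟩ => ?_⟩
    convert hy <;> first | rfl | exact PEmpty.elim ‹_›
  · intro α _ ih _ ι _ s s' Q h
    refine rel_congr (D.ex (s := s) (s' none) (Q := fun a x => ∃ y, Q x fun o => o.elim a y) ?_)
      fun x => ⟨fun ⟨a, y, h⟩ => ⟨_, h⟩, fun ⟨y, h⟩ => ⟨y none, fun a => y (some a), ?_⟩⟩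
    · refine ih (fun a => s' (some a)) (Q := fun w y => Q (fun t => w (some t))
        fun o => o.elim (w none) y) ?_
      refine rel_congr (D.subst (s' := Sum.elim (fun o : Option ι => o.elim (s' none) s)
        fun a => s' (some a)) (Sum.elim (fun i => .inl (some i))
          fun o => o.elim (.inl none) .inr) ?_ h) fun x => ?_
      · rintro (i | _ | i) <;> rfl
      · refine iff_of_eq (congrArg (Q _) (funext fun o => ?_))
        cases o <;> rfl
    · convert h with o
      cases o <;> rfl

theorem all_sum {κ : Type} [Finite κ] : ∀ {ι : Type} [Finite ι] {s : ι → Fin k} (s' : κ → Fin k)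
    {Q : (ι → ZMod 2) → (κ → ZMod 2) → Prop},
    D.rel (Sum.elim s s') (fun w => Q (fun i => w (.inl i)) fun j => w (.inr j)) →
      D.rel s fun x => ∀ y, Q x y := by
  refine Finite.induction_empty_option (P := fun κ : Type => ∀ [Finite κ], ∀ {ι : Type} [Finite ι]
    {s : ι → Fin k} (s' : κ → Fin k) {Q : (ι → ZMod 2) → (κ → ZMod 2) → Prop},
    D.rel (Sum.elim s s') (fun w => Q (fun i => w (.inl i)) fun j => w (.inr j)) →
      D.rel s fun x => ∀ y, Q x y) ?_ ?_ ?_ κ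
  · intro α β e ih _ ι _ s s' Q h
    have : Finite α := Finite.of_equiv β e.symm
    refine rel_congr (ih (s := s) (fun a => s' (e a)) (Q := fun x y => Q x fun b => y (e.symm b)) ?_)
      fun x => ⟨fun h y => by simpa using h fun a => y (e a), fun h y => h _⟩
    exact D.subst (s' := Sum.elim s fun a => s' (e a)) (Sum.map id e.symm)
      (by rintro (i | i) <;> simp) h
  · intro _ ι _ s s' Q h
    refine rel_congr (D.subst (s' := s) (Sum.elim id PEmpty.elim) (by rintro (i | i); rfl; cases i) h)
      fun x => ⟨fun hy y => ?_, fun h => h _⟩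
    convert hy <;> first | rfl | exact PEmpty.elim ‹_›
  · intro α _ ih _ ι _ s s' Q h
    refine rel_congr (D.all (s := s) (s' none) (Q := fun a x => ∀ y, Q x fun o => o.elim a y) ?_)
      fun x => ⟨fun h y => ?_, fun h a y => h _⟩
    · refine ih (fun a => s' (some a)) (Q := fun w y => Q (fun t => w (some t))
        fun o => o.elim (w none) y) ?_
      refine rel_congr (D.subst (s' := Sum.elim (fun o : Option ι => o.elim (s' none) s)
        fun a => s' (some a)) (Sum.elim (fun i => .inl (some i))
          fun o => o.elim (.inl none) .inr) ?_ h) fun x => ?_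
      · rintro (i | _ | i) <;> rfl
      · refine iff_of_eq (congrArg (Q _) (funext fun o => ?_))
        cases o <;> rfl
    · convert h (y none) fun a => y (some a) with o
      cases o <;> rfl

/-- A predicate preserved by all surjective polymorphisms of `D` belongs to `D`. -/
theorem rel_of_forall_inv {R : (ι → ZMod 2) → Prop}
    (h : ∀ (m : Type) [Finite m] [Nonempty m] (f : Fin k → (m → ZMod 2) → ZMod 2)
      (hf : ∀ i, Function.Surjective (f i)), D ≤ inv f hf → (inv f hf).rel s R) : D.rel s R := by
  by_cases hR : ∃ x, R x
  swap
  · exact rel_congr D.bot' fun x => ⟨False.elim, fun hx => hR ⟨x, hx⟩⟩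
  have hne : Nonempty {x // R x} := hR.elim fun x hx => ⟨⟨x, hx⟩⟩
  -- The arguments of the operations are indexed by a tuple of `R` together with arbitrary values `y
  -- (i, a)`. The second component is used to enforce surjectivity.
  let m := {x // R x} × (Fin k × ZMod 2 → ZMod 2)
  -- Here `z` is the value table of a family of operations, and `Γ z` says that the family is a
  -- polymorphism of `D`.
  let Γ : (Fin k × (m → ZMod 2) → ZMod 2) → Prop := fun z =>
    ∀ (κ : Type) (_ : Finite κ) (t : κ → Fin k) (Q : (κ → ZMod 2) → Prop) (_ : D.rel t Q)
      (M : m → κ → ZMod 2) (_ : ∀ j, Q (M j)), Q fun p => z (t p, fun j => M j p)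
  have hΓ : D.rel Prod.fst Γ := by
    refine iInter fun κ => iInter fun _ => iInter fun t => iInter fun Q => iInter fun hQ =>
      iInter fun M => iInter fun _ => ?_
    exact D.subst (s' := Prod.fst) (fun p => (t p, fun j => M j p)) (fun _ => rfl) hQ
  -- This formula over `D` defines `R`. The choice `y = Prod.snd` makes each operation hit every
  -- value, so `x` is the image of tuples of `R` under a surjective polymorphism. Conversely, for
  -- `x` in `R` the projection to `(x, y)` is a witness.
  have key : D.rel s fun x => ∀ y : Fin k × ZMod 2 → ZMod 2, ∃ z : Fin k × (m → ZMod 2) → ZMod 2,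
      Γ z ∧ (∀ p, z (s p, fun j => j.1.1 p) = x p) ∧ ∀ q, z (q.1, fun j => j.2 q) = y q := by
    refine all_sum Prod.fst (ex_sum (s := Sum.elim s Prod.fst) Prod.fst
      (Q := fun w z => Γ z ∧ (∀ p, z (s p, fun j => j.1.1 p) = w (.inl p)) ∧
        ∀ q, z (q.1, fun j => j.2 q) = w (.inr q)) ?_)
    refine D.and (D.subst (s := Prod.fst) Sum.inr (fun _ => rfl) hΓ) (D.and ?_ ?_)
    · exact iInter fun p => D.eq' _ _ rfl
    · exact iInter fun p => D.eq' _ _ rfl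
  refine rel_congr key fun x => ⟨fun hx => ?_, fun hx y => ?_⟩
  · obtain ⟨z, hz, h₁, h₂⟩ := hx Prod.snd
    have := h m (fun i v => z (i, v)) (fun i a => ⟨_, h₂ (i, a)⟩)
      (fun {κ} _ t Q hQ M hM => hz κ ‹_› t Q hQ M hM) (fun j => j.1.1) fun j => j.1.2
    simpa [h₁] using this
  · exact ⟨fun v => v.2 (⟨x, hx⟩, y), fun κ _ t Q _ M hM => hM _, fun _ => rfl, fun _ => rfl⟩

end QClone

theorem forall_bit {P : ZMod 2 → Prop} : (∀ x, P x) ↔ P 0 ∧ P 1 :=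
  Fin.forall_fin_two

theorem exists_bit {P : ZMod 2 → Prop} : (∃ x, P x) ↔ P 0 ∨ P 1 :=
  Fin.exists_fin_two

theorem bit_eq_or (a : ZMod 2) : a = 0 ∨ a = 1 := by
  revert a
  decide

theorem bit_add_one_ne (a : ZMod 2) : a + 1 ≠ a := by
  revert a
  decide

theorem bit_eq_add_one {a b : ZMod 2} : a ≠ b → a = b + 1 := by
  revert a b
  decide

theorem bit_one_add_one : (1 : ZMod 2) + 1 = 0 := rfl

/-! ### Small canonical relations and the implications between them -/

namespace QClone

variable {k : ℕ}

section Small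

variable (D : QClone k)

def R1 (i : Fin k) (P : ZMod 2 → Prop) : Prop := D.rel ![i] fun x => P (x 0)

def R2 (i j : Fin k) (P : ZMod 2 → ZMod 2 → Prop) : Prop := D.rel ![i, j] fun x => P (x 0) (x 1)

def R3 (i j l : Fin k) (P : ZMod 2 → ZMod 2 → ZMod 2 → Prop) : Prop :=
  D.rel ![i, j, l] fun x => P (x 0) (x 1) (x 2)

def R4 (i j l m : Fin k) (P : ZMod 2 → ZMod 2 → ZMod 2 → ZMod 2 → Prop) : Prop :=
  D.rel ![i, j, l, m] fun x => P (x 0) (x 1) (x 2) (x 3)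

def R5 (i j l m n : Fin k) (P : ZMod 2 → ZMod 2 → ZMod 2 → ZMod 2 → ZMod 2 → Prop) : Prop :=
  D.rel ![i, j, l, m, n] fun x => P (x 0) (x 1) (x 2) (x 3) (x 4)

/-- `x = 0 ∨ y = 1`. -/
def C1 (i : Fin k) : Prop := D.R2 i i fun x y => x = 0 ∨ y = 1

/-- `x = y ∨ u = b`. -/
def C2 (i j : Fin k) (b : ZMod 2) : Prop := D.R3 i i j fun x y u => x = y ∨ u = b

/-- `x = y ∨ u = v`. -/
def C3 (i j : Fin k) : Prop := D.R4 i i j j fun x y u v => x = y ∨ u = v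

/-- `x + y = u + v`. -/
def C5 (i j : Fin k) : Prop := D.R4 i i j j fun x y u v => x + y = u + v

end Small

variable {D : QClone k} {ι : Type} [Finite ι] {s : ι → Fin k} {i j l m n : Fin k}

theorem R1.atom {P} (h : D.R1 i P) (a : ι) (ha : s a = i) : D.rel s fun x => P (x a) :=
  D.subst (s' := s) ![a] (by simp [ha]) h

theorem R2.atom {P} (h : D.R2 i j P) (a b : ι) (ha : s a = i) (hb : s b = j) :
    D.rel s fun x => P (x a) (x b) :=
  D.subst (s' := s) ![a, b] (by simp [Fin.forall_fin_two, ha, hb]) h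

theorem R3.atom {P} (h : D.R3 i j l P) (a b c : ι) (ha : s a = i) (hb : s b = j) (hc : s c = l) :
    D.rel s fun x => P (x a) (x b) (x c) :=
  D.subst (s' := s) ![a, b, c] (by simp [Fin.forall_fin_succ, ha, hb, hc]) h

theorem R4.atom {P} (h : D.R4 i j l m P) (a b c d : ι) (ha : s a = i) (hb : s b = j)
    (hc : s c = l) (hd : s d = m) : D.rel s fun x => P (x a) (x b) (x c) (x d) :=
  D.subst (s' := s) ![a, b, c, d] (by simp [Fin.forall_fin_succ, ha, hb, hc, hd]) h

theorem R5.atom {P} (h : D.R5 i j l m n P) (a b c d e : ι) (ha : s a = i) (hb : s b = j)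
    (hc : s c = l) (hd : s d = m) (he : s e = n) :
    D.rel s fun x => P (x a) (x b) (x c) (x d) (x e) :=
  D.subst (s' := s) ![a, b, c, d, e] (by simp [Fin.forall_fin_succ, ha, hb, hc, hd, he]) h

theorem R2.swap {P} (h : D.R2 i j P) : D.R2 j i fun x y => P y x := R2.atom h 1 0 rfl rfl

theorem C3.symm (h : D.C3 i j) : D.C3 j i :=
  rel_congr (R4.atom h 2 3 0 1 rfl rfl rfl rfl) fun _ => or_comm

theorem C5.symm (h : D.C5 i j) : D.C5 j i :=
  rel_congr (R4.atom h 2 3 0 1 rfl rfl rfl rfl) fun _ => eq_comm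

/-- If both outer alternatives fail, `w` would have to equal both `u` and `v`, and these are
universally quantified. `C3.trans` rests on the same formula. -/
theorem C3.trans_C2 {b : ZMod 2} (h : D.C3 i j) (h' : D.C2 j l b) : D.C2 i l b := by
  refine rel_congr (P := fun x => ∀ u v, ∃ w, (u = w ∨ x 2 = b) ∧ (x 0 = x 1 ∨ w = v))
    (D.all j (D.all j (D.ex j (D.and
      (R3.atom h' (some (some none)) none (some (some (some 2))) rfl rfl rfl)
      (R4.atom h (some (some (some 0))) (some (some (some 1))) none (some none)
        rfl rfl rfl rfl))))) fun x => ?_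
  generalize x 0 = a, x 1 = c, x 2 = d
  clear h h'
  revert a b c d
  decide

theorem C3.trans (h : D.C3 i j) (h' : D.C3 j l) : D.C3 i l := by
  refine rel_congr (P := fun x => ∀ u v, ∃ w, (u = w ∨ x 2 = x 3) ∧ (x 0 = x 1 ∨ w = v))
    (D.all j (D.all j (D.ex j (D.and
      (R4.atom h' (some (some none)) none (some (some (some 2))) (some (some (some 3)))
        rfl rfl rfl rfl)
      (R4.atom h (some (some (some 0))) (some (some (some 1))) none (some none)
        rfl rfl rfl rfl))))) fun x => ?_
  generalize x 0 = a, x 1 = c, x 2 = d, x 3 = b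
  revert a b c d
  decide

theorem C3.self (h : D.C3 i j) : D.C3 i i := h.trans h.symm

/-- If `x 0 ≠ x 1` and `x 2 ≠ x 3`, the chain through `w` forces `x 1 = x 2` and the chain through
`w'` forces `x 0 = x 2`, a contradiction. -/
theorem C3.of_three (h : D.R3 i i i fun x y z => x = y ∨ y = z) : D.C3 i i := by
  refine rel_congr (P := fun x => ∃ w w', (x 0 = x 1 ∨ x 1 = w) ∧ (w = x 2 ∨ x 2 = x 3) ∧
      (x 1 = x 0 ∨ x 0 = w') ∧ (w' = x 2 ∨ x 2 = x 3))
    (D.ex i (D.ex i (D.and (R3.atom h (some (some 0)) (some (some 1)) (some none) rfl rfl rfl)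
      (D.and (R3.atom h (some none) (some (some 2)) (some (some 3)) rfl rfl rfl)
        (D.and (R3.atom h (some (some 1)) (some (some 0)) none rfl rfl rfl)
          (R3.atom h none (some (some 2)) (some (some 3)) rfl rfl rfl)))))) fun x => ?_
  generalize x 0 = a, x 1 = c, x 2 = d, x 3 = b
  revert a b c d
  decide

theorem C3.three (h : D.C3 i i) : D.R3 i i i fun x y z => x = y ∨ y = z :=
  R4.atom h 0 1 1 2 rfl rfl rfl rfl

/-- Transport of `C3` along a bijection between two sorts. -/
theorem C3.of_iso {c : ZMod 2} (h : D.C3 i i) (hE : D.R2 i l fun x y => x = y + c) :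
    D.C3 i l := by
  refine rel_congr (P := fun x => ∃ u v, u = x 2 + c ∧ v = x 3 + c ∧ (x 0 = x 1 ∨ u = v))
    (D.ex i (D.ex i (D.and (R2.atom hE (some none) (some (some 2)) rfl rfl)
      (D.and (R2.atom hE none (some (some 3)) rfl rfl)
        (R4.atom h (some (some 0)) (some (some 1)) (some none) none rfl rfl rfl rfl)))))
    fun x => ?_
  simp

theorem C5.trans (h : D.C5 i j) (h' : D.C5 j l) : D.C5 i l := by
  refine rel_congr (P := fun x => ∃ u v, x 0 + x 1 = u + v ∧ u + v = x 2 + x 3)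
    (D.ex j (D.ex j (D.and
      (R4.atom h (some (some 0)) (some (some 1)) (some none) none rfl rfl rfl rfl)
      (R4.atom h' (some none) none (some (some 2)) (some (some 3)) rfl rfl rfl rfl))))
    fun x => ?_
  generalize x 0 = a, x 1 = c, x 2 = d, x 3 = b
  revert a b c d
  decide

theorem C5.trans_C2 {b : ZMod 2} (h : D.C5 j i) (h' : D.C2 j l b) : D.C2 i l b := by
  refine rel_congr (P := fun x => ∃ u v, u + v = x 0 + x 1 ∧ (u = v ∨ x 2 = b))
    (D.ex j (D.ex j (D.and
      (R4.atom h (some none) none (some (some 0)) (some (some 1)) rfl rfl rfl rfl)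
      (R3.atom h' (some none) none (some (some 2)) rfl rfl rfl)))) fun x => ?_
  generalize x 0 = a, x 1 = c, x 2 = d
  clear h h'
  revert a b c d
  decide

end QClone

/-! ### Adjoining constants -/

namespace QClone

variable {k : ℕ} {D : QClone k} {ι : Type} [Finite ι] {s : ι → Fin k} {i j l m n : Fin k}

theorem rel_option_const {P : (ι → ZMod 2) → Prop} (l : Fin k) (h : D.rel s P) :
    D.rel (fun o : Option ι => o.elim l s) fun y => P fun t => y (some t) :=
  D.subst (s' := fun o : Option ι => o.elim l s) some (fun _ => rfl) h

/-- The predicates obtained from those of `D` by substituting the constant `a` of sort `l`. -/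
def addConst (D : QClone k) (l : Fin k) (a : ZMod 2) : QClone k where
  rel {ι _} s P := ∃ τ : ZMod 2 → (ι → ZMod 2) → Prop,
    D.rel (fun o : Option ι => o.elim l s) (fun y => τ (y none) fun t => y (some t)) ∧
      ∀ x, P x ↔ τ a x
  bot := ⟨fun _ _ => False, D.bot', fun _ => Iff.rfl⟩
  top := ⟨fun _ _ => True, D.top', fun _ => Iff.rfl⟩
  eq i := ⟨fun _ x => x 0 = x 1, rel_option_const l (D.eq i), fun _ => Iff.rfl⟩
  subst {ι κ _ _ s s' P} v hv h := by
    obtain ⟨τ, hτ, h⟩ := h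
    refine ⟨fun z x => τ z fun i => x (v i), ?_, fun x => h _⟩
    exact D.subst (s' := fun o : Option κ => o.elim l s') (Option.map v)
      (by rintro (_ | i) <;> simp [hv]) hτ
  and := by
    rintro ι _ s P Q ⟨τ, hτ, h⟩ ⟨σ, hσ, h'⟩
    exact ⟨fun z x => τ z x ∧ σ z x, D.and hτ hσ, fun x => and_congr (h x) (h' x)⟩
  ex := by
    rintro ι _ s i Q ⟨τ, hτ, h⟩
    refine ⟨fun z x => ∃ b, τ z fun o => o.elim b x, D.ex i ?_,
      fun x => exists_congr fun b => h fun o => o.elim b x⟩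
    refine rel_congr (D.subst
      (s' := fun o : Option (Option ι) => o.elim i fun o : Option ι => o.elim l s)
      (fun o : Option (Option ι) => o.elim (some none) fun o => o.elim none fun t => some (some t))
      (by rintro (_ | _ | i) <;> rfl) hτ) fun y => iff_of_eq (congrArg _ (funext fun o => ?_))
    cases o <;> rfl
  all := by
    rintro ι _ s i Q ⟨τ, hτ, h⟩
    refine ⟨fun z x => ∀ b, τ z fun o => o.elim b x, D.all i ?_,
      fun x => forall_congr' fun b => h fun o => o.elim b x⟩
    refine rel_congr (D.subst
      (s' := fun o : Option (Option ι) => o.elim i fun o : Option ι => o.elim l s)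
      (fun o : Option (Option ι) => o.elim (some none) fun o => o.elim none fun t => some (some t))
      (by rintro (_ | _ | i) <;> rfl) hτ) fun y => iff_of_eq (congrArg _ (funext fun o => ?_))
    cases o <;> rfl

theorem le_addConst (l : Fin k) (a : ZMod 2) : D ≤ D.addConst l a :=
  fun {_ _ _ P} h => ⟨fun _ => P, rel_option_const l h, fun _ => Iff.rfl⟩

theorem addConst_R1 (l : Fin k) (a : ZMod 2) : (D.addConst l a).R1 l (· = a) :=
  ⟨fun z x => x 0 = z, D.eq' (some 0) none rfl, fun _ => Iff.rfl⟩

theorem exists_R3_of_addConst {a : ZMod 2} {P} (h : (D.addConst l a).R2 i j P) :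
    ∃ t : ZMod 2 → ZMod 2 → ZMod 2 → Prop, D.R3 i j l t ∧ ∀ x y, t x y a ↔ P x y := by
  obtain ⟨τ, hτ, h⟩ := h
  refine ⟨fun x y z => τ z ![x, y], ?_, fun x y => (h ![x, y]).symm⟩
  refine rel_congr (D.subst (s' := ![i, j, l]) (fun o => o.elim 2 ![0, 1])
    (by rintro (_ | p); rfl; fin_cases p <;> rfl) hτ) fun x => ?_
  refine iff_of_eq (congrArg (τ _) (funext fun p => ?_))
  fin_cases p <;> rfl

theorem exists_R4_of_addConst {a : ZMod 2} {P} (h : (D.addConst m a).R3 i j l P) :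
    ∃ t : ZMod 2 → ZMod 2 → ZMod 2 → ZMod 2 → Prop,
      D.R4 i j l m t ∧ ∀ x y u, t x y u a ↔ P x y u := by
  obtain ⟨τ, hτ, h⟩ := h
  refine ⟨fun x y u z => τ z ![x, y, u], ?_, fun x y u => (h ![x, y, u]).symm⟩
  refine rel_congr (D.subst (s' := ![i, j, l, m]) (fun o => o.elim 3 ![0, 1, 2])
    (by rintro (_ | p); rfl; fin_cases p <;> rfl) hτ) fun x => ?_
  refine iff_of_eq (congrArg (τ _) (funext fun p => ?_))
  fin_cases p <;> rfl

theorem exists_R5_of_addConst {a : ZMod 2} {P} (h : (D.addConst n a).R4 i j l m P) :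
    ∃ t : ZMod 2 → ZMod 2 → ZMod 2 → ZMod 2 → ZMod 2 → Prop,
      D.R5 i j l m n t ∧ ∀ x y u v, t x y u v a ↔ P x y u v := by
  obtain ⟨τ, hτ, h⟩ := h
  refine ⟨fun x y u v z => τ z ![x, y, u, v], ?_, fun x y u v => (h ![x, y, u, v]).symm⟩
  refine rel_congr (D.subst (s' := ![i, j, l, m, n]) (fun o => o.elim 4 ![0, 1, 2, 3])
    (by rintro (_ | p); rfl; fin_cases p <;> rfl) hτ) fun x => ?_
  refine iff_of_eq (congrArg (τ _) (funext fun p => ?_))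
  fin_cases p <;> rfl

/-- Of the constant `a` of sort `l` only `δ a` is used if `δ` fails at the other constant. -/
theorem R1.eq_const {δ : ZMod 2 → Prop} {a : ZMod 2} (h : D.R1 l δ) (ha : δ a)
    (ha' : ¬ δ (a + 1)) : D.R1 l (· = a) :=
  rel_congr h fun x => ⟨fun hx => by
    by_contra hne
    rw [bit_eq_add_one hne] at hx
    exact ha' hx, fun hx => hx ▸ ha⟩

/-- The relation is the slice `z = a` of a predicate `t` of `D`, and the cases concern the slice at
`a + 1`. If that slice misses part of the diagonal, the constant `a` is definable and can be
substituted. Otherwise quantifying `z` by `∀` or `∃` recovers the relation, unless the other slice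
is the reverse order. The lemmas for `C2`, `C3` and `C5` follow the same pattern. -/
theorem C1.of_addConst {a : ZMod 2} (h : (D.addConst l a).C1 i) : D.C1 i ∨ D.C3 i i := by
  obtain ⟨t, ht, hta⟩ := exists_R3_of_addConst h
  by_cases hδ : ∀ x, t x x (a + 1)
  swap
  · have hc : D.R1 l (· = a) := R1.eq_const (δ := fun z => ∀ x, t x x z)
      (D.all i (ht.atom none none (some 0) rfl rfl rfl)) (fun x => by simp [hta, bit_eq_or]) hδ
    exact .inl <| rel_congr (P := fun x => ∃ z, z = a ∧ t (x 0) (x 1) z)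
      (D.ex l (D.and (hc.atom none rfl) (ht.atom (some 0) (some 1) none rfl rfl rfl)))
      fun x => by simp [hta]
  have hall : D.R2 i i fun x y => ∀ z, t x y z :=
    D.all l (ht.atom (some 0) (some 1) none rfl rfl rfl)
  have hex : D.R2 i i fun x y => ∃ z, t x y z :=
    D.ex l (ht.atom (some 0) (some 1) none rfl rfl rfl)
  by_cases h₁ : t 0 1 (a + 1)
  · refine .inl <| rel_congr hall fun x => ?_
    generalize x 0 = b, x 1 = c
    revert b c
    rcases bit_eq_or a with rfl | rfl <;>
      simp_all [forall_bit, bit_one_add_one]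
  by_cases h₂ : t 1 0 (a + 1)
  swap
  · refine .inl <| rel_congr hex fun x => ?_
    generalize x 0 = b, x 1 = c
    revert b c
    rcases bit_eq_or a with rfl | rfl <;>
      simp_all [forall_bit, exists_bit, bit_one_add_one]
  -- The two slices are opposite orders. The clause `∀ w, t w (x 2) z` holds exactly when `x 2` is
  -- the top of the order at `z`, so `x 2` selects the slice.
  · refine .inr <| C3.of_three <| rel_congr
      (P := fun x => ∃ z, (∀ w, t w (x 2) z) ∧ t (x 0) (x 1) z)
      (D.ex l (D.and (D.all i (ht.atom none (some (some 2)) (some none) rfl rfl rfl))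
        (ht.atom (some 0) (some 1) none rfl rfl rfl))) fun x => ?_
    generalize x 0 = b, x 1 = c, x 2 = d
    revert b c d
    rcases bit_eq_or a with rfl | rfl <;>
      simp_all [forall_bit, exists_bit, bit_one_add_one]

theorem C2.of_addConst {a b : ZMod 2} (h : (D.addConst l a).C2 i j b) :
    D.C2 i j b ∨ D.C3 i j := by
  obtain ⟨t₀, ht₀, ht₀a⟩ := exists_R4_of_addConst h
  obtain ⟨t, ht, hta, hsymm⟩ : ∃ t : ZMod 2 → ZMod 2 → ZMod 2 → ZMod 2 → Prop,
      D.R4 i i j l t ∧ (∀ x y u, t x y u a ↔ (x = y ∨ u = b)) ∧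
        ∀ x y u z, t x y u z → t y x u z :=
    ⟨fun x y u z => t₀ x y u z ∧ t₀ y x u z,
      D.and ht₀ (ht₀.atom 1 0 2 3 rfl rfl rfl rfl),
      fun x y u => by simp [ht₀a, eq_comm], fun x y u z h => h.symm⟩
  by_cases hδ : ∀ x u, t x x u (a + 1)
  swap
  · have hc : D.R1 l (· = a) := R1.eq_const (δ := fun z => ∀ x u, t x x u z)
      (D.all i (D.all j (ht.atom (some none) (some none) none (some (some 0)) rfl rfl rfl rfl)))
      (fun x => by simp [hta]) hδ
    exact .inl <| rel_congr (P := fun x => ∃ z, z = a ∧ t (x 0) (x 1) (x 2) z)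
      (D.ex l (D.and (hc.atom none rfl)
        (ht.atom (some 0) (some 1) (some 2) none rfl rfl rfl rfl))) fun x => by simp [hta]
  have hall : D.R3 i i j fun x y u => ∀ z, t x y u z :=
    D.all l (ht.atom (some 0) (some 1) (some 2) none rfl rfl rfl rfl)
  have hex : D.R3 i i j fun x y u => ∃ z, t x y u z :=
    D.ex l (ht.atom (some 0) (some 1) (some 2) none rfl rfl rfl rfl)
  have hs : ∀ u z, t 0 1 u z ↔ t 1 0 u z := fun u z => ⟨hsymm _ _ _ _, hsymm _ _ _ _⟩
  by_cases h₁ : t 0 1 b (a + 1)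
  · refine .inl <| rel_congr hall fun x => ?_
    generalize x 0 = c, x 1 = d, x 2 = e
    revert c d e
    clear hsymm
    rcases bit_eq_or a with rfl | rfl <;> rcases bit_eq_or b with rfl | rfl <;>
      simp_all [forall_bit, bit_one_add_one]
  by_cases h₂ : t 0 1 (b + 1) (a + 1)
  swap
  · refine .inl <| rel_congr hex fun x => ?_
    generalize x 0 = c, x 1 = d, x 2 = e
    revert c d e
    clear hsymm
    rcases bit_eq_or a with rfl | rfl <;> rcases bit_eq_or b with rfl | rfl <;>
      simp_all [forall_bit, exists_bit, bit_one_add_one]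
  -- The other slice is `x = y ∨ u = b + 1`, so the clause `∀ w w'` makes `x 3` the constant that
  -- belongs to `z`.
  · refine .inr <| rel_congr
      (P := fun x => ∃ z, (∀ w w', t w w' (x 3) z) ∧ t (x 0) (x 1) (x 2) z)
      (D.ex l (D.and (D.all i (D.all i (ht.atom (some none) none (some (some (some 3)))
          (some (some none)) rfl rfl rfl rfl)))
        (ht.atom (some 0) (some 1) (some 2) none rfl rfl rfl rfl))) fun x => ?_
    generalize x 0 = c, x 1 = d, x 2 = e, x 3 = g
    revert c d e g
    clear hsymm
    rcases bit_eq_or a with rfl | rfl <;> rcases bit_eq_or b with rfl | rfl <;>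
      simp_all [forall_bit, exists_bit, bit_one_add_one]

theorem C3.of_addConst {a : ZMod 2} (h : (D.addConst l a).C3 i j) : D.C3 i j := by
  obtain ⟨t, ht, hta⟩ := exists_R5_of_addConst h
  by_cases hδ : (∀ x u v, t x x u v (a + 1)) ∧ ∀ x y u, t x y u u (a + 1)
  swap
  · have hc : D.R1 l (· = a) := R1.eq_const
      (δ := fun z => (∀ x u v, t x x u v z) ∧ ∀ x y u, t x y u u z)
      (D.and
        (D.all i (D.all j (D.all j (ht.atom (some (some none)) (some (some none)) (some none) none
          (some (some (some 0))) rfl rfl rfl rfl rfl))))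
        (D.all i (D.all i (D.all j (ht.atom (some (some none)) (some none) none none
          (some (some (some 0))) rfl rfl rfl rfl rfl)))))
      (by simp [hta]) hδ
    exact rel_congr (P := fun x => ∃ z, z = a ∧ t (x 0) (x 1) (x 2) (x 3) z)
      (D.ex l (D.and (hc.atom none rfl)
        (ht.atom (some 0) (some 1) (some 2) (some 3) none rfl rfl rfl rfl rfl)))
      fun x => by simp [hta]
  have hall : D.R4 i i j j fun x y u v => ∀ z, t x y u v z :=
    D.all l (ht.atom (some 0) (some 1) (some 2) (some 3) none rfl rfl rfl rfl rfl)
  refine rel_congr hall fun x => ⟨fun h => (hta ..).1 (h a), fun h z => ?_⟩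
  by_cases hz : z = a
  · rw [hz, hta]
    exact h
  · rw [bit_eq_add_one hz]
    rcases h with h | h
    · rw [h]
      exact hδ.1 _ _ _
    · rw [h]
      exact hδ.2 _ _ _

end QClone

theorem forall_bit_of (a : ZMod 2) {P : ZMod 2 → Prop} : (∀ x, P x) ↔ P a ∧ P (a + 1) := by
  rcases bit_eq_or a with rfl | rfl
  · exact forall_bit
  · exact forall_bit.trans and_comm

theorem exists_bit_of (a : ZMod 2) {P : ZMod 2 → Prop} : (∃ x, P x) ↔ P a ∨ P (a + 1) := by
  rcases bit_eq_or a with rfl | rfl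
  · exact exists_bit
  · exact exists_bit.trans or_comm

namespace QClone

variable {k : ℕ} {D : QClone k} {ι : Type} [Finite ι] {s : ι → Fin k} {i j l m n : Fin k}

/-- The remaining case for `C5`: the other slice contains a point with `x ≠ y`, `u = v`. This makes
`x = y ∨ z = a + 1` definable, which can free `x` and `y` on that slice. -/
theorem C5.of_slice {a u₀ : ZMod 2} {t : ZMod 2 → ZMod 2 → ZMod 2 → ZMod 2 → ZMod 2 → Prop}
    (ht : D.R5 i i j j l t) (hta : ∀ x y u v, t x y u v a ↔ x + y = u + v)
    (hs : ∀ x y u v z, t x y u v z ↔ t y x u v z) (hs' : ∀ x y u v z, t x y u v z ↔ t x y v u z)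
    (hd : ∀ x u, t x x u u (a + 1)) (h₀ : ¬ t 0 1 0 1 (a + 1)) (h₁ : t 0 1 u₀ u₀ (a + 1)) :
    D.C5 i j ∨ D.C3 i j := by
  have hK : D.C2 i l (a + 1) := by
    refine rel_congr (P := fun x => ∃ u, t (x 0) (x 1) u u (x 2))
      (D.ex j (ht.atom (some 0) (some 1) none none (some 2) rfl rfl rfl rfl rfl)) fun x => ?_
    generalize x 0 = b, x 1 = c
    refine forall_bit_of a (P := fun z => (∃ u, t b c u u z) ↔ b = c ∨ z = a + 1) |>.2
      ⟨?_, ?_⟩ (x 2)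
    · revert b c
      simp [hta, forall_bit, (bit_add_one_ne a).symm]
      exact ⟨⟨0, rfl⟩, 0, rfl⟩
    · have := (hs 0 1 u₀ u₀ (a + 1)).1 h₁
      simp only [or_true, iff_true]
      revert b c
      simp only [forall_bit]
      exact ⟨⟨⟨0, hd _ _⟩, _, h₁⟩, ⟨_, this⟩, ⟨0, hd _ _⟩⟩
  -- `σ` agrees with `t` at `a`, while at `a + 1` it ignores `x` and `y`: there it is either full or
  -- the relation `u = v`.
  let σ : ZMod 2 → ZMod 2 → ZMod 2 → ZMod 2 → ZMod 2 → Prop := fun x y u v z =>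
    ∃ x' y', t x' y' u v z ∧ (x = x' ∨ z = a + 1) ∧ (y = y' ∨ z = a + 1)
  have hσ : D.R5 i i j j l σ :=
    D.ex i (D.ex i (D.and (ht.atom (some none) none (some (some 2)) (some (some 3)) (some (some 4))
      rfl rfl rfl rfl rfl)
      (D.and (hK.atom (some (some 0)) (some none) (some (some 4)) rfl rfl rfl)
        (hK.atom (some (some 1)) none (some (some 4)) rfl rfl rfl))))
  have hσa : ∀ x y u v, σ x y u v a ↔ x + y = u + v := fun x y u v => by
    simp [σ, hta, (bit_add_one_ne a).symm]
  have hσa' : ∀ x y u v, σ x y u v (a + 1) ↔ ∃ x' y', t x' y' u v (a + 1) := fun x y u v => by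
    simp [σ]
  by_cases h₂ : ∃ x, t x x 0 1 (a + 1)
  · obtain ⟨x₀, h₂⟩ := h₂
    refine .inl <| rel_congr (P := fun x => ∀ z, σ (x 0) (x 1) (x 2) (x 3) z)
      (D.all l (hσ.atom (some 0) (some 1) (some 2) (some 3) none rfl rfl rfl rfl rfl))
      fun x => ?_
    rw [forall_bit_of a, hσa, hσa', and_iff_left]
    generalize x 2 = u, x 3 = v
    revert u v
    simp only [forall_bit]
    exact ⟨⟨⟨0, 0, hd _ _⟩, _, _, h₂⟩, ⟨_, _, (hs' ..).1 h₂⟩, ⟨0, 0, hd _ _⟩⟩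
  · push Not at h₂
    have hσb : ∀ x y u v, σ x y u v (a + 1) ↔ u = v := fun x y u v => by
      rw [hσa']
      have h₃ : ∀ x y, ¬ t x y 0 1 (a + 1) := by
        have := (hs 0 1 0 1 (a + 1)).not.1 h₀
        simp only [forall_bit]
        exact ⟨⟨h₂ 0, h₀⟩, this, h₂ 1⟩
      have h₄ : ∀ x y, ¬ t x y 1 0 (a + 1) := fun x y => (hs' ..).not.1 (h₃ x y)
      revert u v
      simp only [forall_bit, h₃, h₄]
      exact ⟨⟨⟨fun _ => trivial, fun _ => ⟨0, 0, hd _ _⟩⟩, by simp⟩, by simp,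
        ⟨fun _ => trivial, fun _ => ⟨0, 0, hd _ _⟩⟩⟩
    have hG : D.R4 i i j j fun x y u v => u = v ∨ x ≠ y := by
      refine rel_congr (P := fun x => ∃ z, σ (x 0) (x 1) (x 2) (x 3) z)
        (D.ex l (hσ.atom (some 0) (some 1) (some 2) (some 3) none rfl rfl rfl rfl rfl))
        fun x => ?_
      rw [exists_bit_of a, hσa, hσb]
      generalize x 0 = b, x 1 = c, x 2 = d, x 3 = e
      clear * -
      revert b c d e
      decide
    -- The universal clause says `w ≠ x 1`, hence `x 0 ≠ w` means `x 0 = x 1`.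
    refine .inr <| rel_congr
      (P := fun x => ∃ w, (x 2 = x 3 ∨ x 0 ≠ w) ∧ ∀ u v : ZMod 2, u = v ∨ w ≠ x 1)
      (D.ex i (D.and (hG.atom (some 0) none (some 2) (some 3) rfl rfl rfl rfl)
        (D.all j (D.all j (hG.atom (some (some none)) (some (some (some 1))) (some none) none
          rfl rfl rfl rfl))))) fun x => ?_
    generalize x 0 = b, x 1 = c, x 2 = d, x 3 = e
    clear * -
    revert b c d e
    decide

theorem C5.of_addConst {a : ZMod 2} (h : (D.addConst l a).C5 i j) : D.C5 i j ∨ D.C3 i j := by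
  obtain ⟨t₀, ht₀, ht₀a⟩ := exists_R5_of_addConst h
  obtain ⟨t, ht, hta, hs, hs'⟩ : ∃ t : ZMod 2 → ZMod 2 → ZMod 2 → ZMod 2 → ZMod 2 → Prop,
      D.R5 i i j j l t ∧ (∀ x y u v, t x y u v a ↔ x + y = u + v) ∧
        (∀ x y u v z, t x y u v z ↔ t y x u v z) ∧ ∀ x y u v z, t x y u v z ↔ t x y v u z := by
    refine ⟨fun x y u v z => (t₀ x y u v z ∧ t₀ y x u v z) ∧ t₀ x y v u z ∧ t₀ y x v u z,
      D.and (D.and ht₀ (ht₀.atom 1 0 2 3 4 rfl rfl rfl rfl rfl))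
        (D.and (ht₀.atom 0 1 3 2 4 rfl rfl rfl rfl rfl)
          (ht₀.atom 1 0 3 2 4 rfl rfl rfl rfl rfl)),
      fun x y u v => by simp [ht₀a, add_comm], fun x y u v z => by tauto, fun x y u v z => by tauto⟩
  by_cases hd : ∀ x u, t x x u u (a + 1)
  swap
  · have hc : D.R1 l (· = a) := R1.eq_const (δ := fun z => ∀ x u, t x x u u z)
      (D.all i (D.all j (ht.atom (some none) (some none) none none (some (some 0))
        rfl rfl rfl rfl rfl)))
      (fun x => by simp [hta, CharTwo.add_self_eq_zero]) hd
    exact .inl <| rel_congr (P := fun x => ∃ z, z = a ∧ t (x 0) (x 1) (x 2) (x 3) z)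
      (D.ex l (D.and (hc.atom none rfl)
        (ht.atom (some 0) (some 1) (some 2) (some 3) none rfl rfl rfl rfl rfl)))
      fun x => by simp [hta]
  by_cases h₀ : t 0 1 0 1 (a + 1)
  · refine .inl <| rel_congr (P := fun x => ∀ z, t (x 0) (x 1) (x 2) (x 3) z)
      (D.all l (ht.atom (some 0) (some 1) (some 2) (some 3) none rfl rfl rfl rfl rfl))
      fun x => ?_
    rw [forall_bit_of a, hta, and_iff_left_iff_imp]
    have h₁ := (hs ..).1 h₀
    have h₂ := (hs' ..).1 h₀
    have h₃ := (hs' ..).1 h₁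
    generalize x 0 = b, x 1 = c, x 2 = d, x 3 = e
    revert b c d e
    simp [forall_bit, h₀, h₁, h₂, h₃, hd]
  by_cases h₁ : ∃ u, t 0 1 u u (a + 1)
  · obtain ⟨u, h₁⟩ := h₁
    exact C5.of_slice ht hta hs hs' hd h₀ h₁
  by_cases h₂ : ∃ x, t x x 0 1 (a + 1)
  · obtain ⟨x, h₂⟩ := h₂
    refine (C5.of_slice (t := fun x y u v z => t u v x y z)
      (ht.atom 2 3 0 1 4 rfl rfl rfl rfl rfl) (fun x y u v => (hta ..).trans eq_comm)
      (fun x y u v z => hs' ..) (fun x y u v z => hs ..) (fun x u => hd u x) h₀ h₂).imp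
      C5.symm C3.symm
  · push Not at h₁ h₂
    refine .inl <| rel_congr (P := fun x => ∃ z, t (x 0) (x 1) (x 2) (x 3) z)
      (D.ex l (ht.atom (some 0) (some 1) (some 2) (some 3) none rfl rfl rfl rfl rfl))
      fun x => ?_
    rw [exists_bit_of a, hta, or_iff_left_iff_imp]
    have h₃ : ∀ u, ¬ t 1 0 u u (a + 1) := fun u => (hs ..).not.1 (h₁ u)
    have h₄ : ∀ x, ¬ t x x 1 0 (a + 1) := fun u => (hs' ..).not.1 (h₂ u)
    generalize x 0 = b, x 1 = c, x 2 = d, x 3 = e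
    revert b c d e
    simp [forall_bit, h₁, h₂, h₃, h₄, bit_one_add_one]

/-- Adding all constants does not produce new small relations, except in the presence of `C3`. -/
theorem exists_le_const (D : QClone k) : ∃ Z : QClone k, D ≤ Z ∧ (∀ i a, Z.R1 i (· = a)) ∧
    (∀ i, Z.C1 i → D.C1 i ∨ D.C3 i i) ∧ (∀ i j b, Z.C2 i j b → D.C2 i j b ∨ D.C3 i j) ∧
    (∀ i j, Z.C3 i j → D.C3 i j) ∧ ∀ i j, Z.C5 i j → D.C5 i j ∨ D.C3 i j := by
  suffices ∀ F : Finset (Fin k × ZMod 2), ∃ Z : QClone k, D ≤ Z ∧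
      (∀ q ∈ F, Z.R1 q.1 (· = q.2)) ∧
      (∀ i, Z.C1 i → D.C1 i ∨ D.C3 i i) ∧ (∀ i j b, Z.C2 i j b → D.C2 i j b ∨ D.C3 i j) ∧
      (∀ i j, Z.C3 i j → D.C3 i j) ∧ ∀ i j, Z.C5 i j → D.C5 i j ∨ D.C3 i j by
    obtain ⟨Z, h₁, h₂, h₃⟩ := this Finset.univ
    exact ⟨Z, h₁, fun i a => h₂ (i, a) (Finset.mem_univ _), h₃⟩
  intro F
  induction F using Finset.induction_on with
  | empty => exact ⟨D, id, by simp, fun _ => .inl, fun _ _ _ => .inl, fun _ _ => id, fun _ _ => .inl⟩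
  | insert q F _ ih =>
    obtain ⟨Z, hZ, hF, h₁, h₂, h₃, h₅⟩ := ih
    refine ⟨Z.addConst q.1 q.2, fun h => le_addConst _ _ (hZ h), fun r hr => ?_, fun i h => ?_,
      fun i j b h => ?_, fun i j h => h₃ _ _ h.of_addConst, fun i j h => ?_⟩
    · rcases Finset.mem_insert.1 hr with rfl | hr
      · exact addConst_R1 _ _
      · exact le_addConst (D := Z) _ _ (hF r hr)
    · exact (C1.of_addConst h).elim (h₁ i) fun h => .inr (h₃ _ _ h)
    · exact (C2.of_addConst h).elim (h₂ i j b) fun h => .inr (h₃ _ _ h)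
    · exact (C5.of_addConst h).elim (h₅ i j) fun h => .inr (h₃ _ _ h)

end QClone

/-! ### Small relations from slices in two or three coordinates -/

namespace QClone

variable {k : ℕ} {D Z : QClone k} {ι : Type} [Finite ι] {s : ι → Fin k} {i j l m n : Fin k}

section Update

variable [DecidableEq ι] {P : (ι → ZMod 2) → Prop}

theorem rel_option_update (p : ι) (h : D.rel s P) :
    D.rel (fun o : Option ι => o.elim (s p) s)
      fun y => P (Function.update (fun t => y (some t)) p (y none)) := by
  refine rel_congr (D.subst (s' := fun o : Option ι => o.elim (s p) s)
    (fun q => if q = p then none else some q) (fun q => ?_) h) fun y => ?_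
  · split_ifs with hq <;> simp [hq]
  · refine iff_of_eq (congrArg P (funext fun q => ?_))
    by_cases hq : q = p
    · subst hq; simp
    · simp [hq]

theorem ex_update (p : ι) (h : D.rel s P) : D.rel s fun x => ∃ a, P (Function.update x p a) :=
  D.ex (s p) (Q := fun a x => P (Function.update x p a)) (rel_option_update p h)

theorem all_update (p : ι) (h : D.rel s P) : D.rel s fun x => ∀ a, P (Function.update x p a) :=
  D.all (s p) (Q := fun a x => P (Function.update x p a)) (rel_option_update p h)

theorem identify {p q : ι} (hpq : s p = s q) (h : D.rel s P) :
    D.rel s fun x => P (Function.update x p (x q)) := by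
  refine rel_congr (D.subst (s' := s) (fun t => if t = p then q else t) (fun t => ?_) h)
    fun y => ?_
  · split_ifs with ht <;> simp [ht, hpq]
  · refine iff_of_eq (congrArg P (funext fun t => ?_))
    by_cases ht : t = p
    · subst ht; simp
    · simp [ht]

theorem slice_two (hc : ∀ i a, Z.R1 i (· = a)) (h : Z.rel s P) (β : ι → ZMod 2) {p q : ι}
    (hpq : p ≠ q) :
    Z.R2 (s p) (s q) fun u v => P (Function.update (Function.update β p u) q v) := by
  refine rel_congr (P := fun y => ∃ x : ι → ZMod 2, P x ∧ x p = y 0 ∧ x q = y 1 ∧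
      ∀ t, t ≠ p → t ≠ q → x t = β t)
    (ex_sum s (Z.and (Z.subst (s' := Sum.elim ![s p, s q] s) Sum.inr (fun _ => rfl) h)
      (Z.and (Z.eq' (Sum.inr p) (Sum.inl 0) rfl) (Z.and (Z.eq' (Sum.inr q) (Sum.inl 1) rfl)
        (iInter fun t => iInter fun _ => iInter fun _ => (hc (s t) (β t)).atom (Sum.inr t) rfl)))))
    fun y => ⟨fun ⟨x, hx, h₀, h₁, h₂⟩ => ?_, fun h => ⟨_, h, ?_, ?_, fun t ht ht' => ?_⟩⟩
  · convert hx using 1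
    funext t
    by_cases ht : t = q
    · subst ht; simp [h₁]
    by_cases ht' : t = p
    · subst ht'; simp [h₀, ht]
    simp [ht, ht', h₂]
  all_goals simp [*]

theorem slice_three (hc : ∀ i a, Z.R1 i (· = a)) (h : Z.rel s P) (β : ι → ZMod 2) {p q r : ι}
    (hpq : p ≠ q) (hpr : p ≠ r) (hqr : q ≠ r) :
    Z.R3 (s p) (s q) (s r) fun u v w =>
      P (Function.update (Function.update (Function.update β p u) q v) r w) := by
  refine rel_congr (P := fun y => ∃ x : ι → ZMod 2, P x ∧ x p = y 0 ∧ x q = y 1 ∧ x r = y 2 ∧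
      ∀ t, t ≠ p → t ≠ q → t ≠ r → x t = β t)
    (ex_sum s (Z.and (Z.subst (s' := Sum.elim ![s p, s q, s r] s) Sum.inr (fun _ => rfl) h)
      (Z.and (Z.eq' (Sum.inr p) (Sum.inl 0) rfl) (Z.and (Z.eq' (Sum.inr q) (Sum.inl 1) rfl)
        (Z.and (Z.eq' (Sum.inr r) (Sum.inl 2) rfl) (iInter fun t => iInter fun _ => iInter fun _ =>
          iInter fun _ => (hc (s t) (β t)).atom (Sum.inr t) rfl))))))
    fun y => ⟨fun ⟨x, hx, h₀, h₁, h₂, h₃⟩ => ?_, fun h => ⟨_, h, ?_, ?_, ?_, fun t ht ht' ht'' => ?_⟩⟩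
  · convert hx using 1
    funext t
    by_cases ht : t = r
    · subst ht; simp [h₂]
    by_cases ht' : t = q
    · subst ht'; simp [h₁, ht]
    by_cases ht'' : t = p
    · subst ht''; simp [h₀, ht, ht']
    simp [ht, ht', ht'', h₃]
  all_goals simp [*]

end Update

section Slices

variable {R : ZMod 2 → ZMod 2 → ZMod 2 → Prop} {a b c : ZMod 2}

theorem iso_of_anti {P : ZMod 2 → ZMod 2 → Prop} (h : Z.R2 i j P) (h₀₀ : ¬ P a b)
    (h₁₁ : ¬ P (a + 1) (b + 1)) (h₁₀ : P (a + 1) b) (h₀₁ : P a (b + 1)) :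
    Z.R2 i j fun x y => x = y + (a + b + 1) :=
  rel_congr h fun x => by
    generalize x 0 = u, x 1 = v
    revert u v
    rw [forall_bit_of a]
    simp only [forall_bit_of b, h₀₀, h₁₁, h₁₀, h₀₁]
    clear * -
    revert a b
    decide

/-- Up to the bijections between the sorts this is "not all equal". Applied to `x`, the complement
of `y`, and `z` of one sort, it reads `x = y ∨ y = z`. -/
theorem C3.of_iso_of_nae (h : Z.R3 i j l fun x y z =>
      ¬ (x = a ∧ y = b ∧ z = c) ∧ ¬ (x = a + 1 ∧ y = b + 1 ∧ z = c + 1))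
    (h₁ : Z.R2 i j fun x y => x = y + (a + b + 1)) (h₂ : Z.R2 j l fun x y => x = y + (b + c + 1)) :
    Z.C3 i i := by
  refine C3.of_three <| rel_congr (P := fun x => ∃ y z u : ZMod 2,
      (¬ (x 0 = a ∧ y = b ∧ z = c) ∧ ¬ (x 0 = a + 1 ∧ y = b + 1 ∧ z = c + 1)) ∧
        x 1 = y + (a + b + 1) ∧ x 2 = u + (a + b + 1) ∧ u = z + (b + c + 1))
    (Z.ex j (Z.ex l (Z.ex j (Z.and
      (h.atom (some (some (some 0))) (some (some none)) (some none) rfl rfl rfl)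
      (Z.and (h₁.atom (some (some (some 1))) (some (some none)) rfl rfl)
        (Z.and (h₁.atom (some (some (some 2))) none rfl rfl)
          (h₂.atom none (some none) rfl rfl))))))) fun x => ?_
  generalize x 0 = u, x 1 = v, x 2 = w
  clear * -
  revert a b c u v w
  decide

/-- The slice at `c` is a bijection, and the projection forgetting the third coordinate misses only
`(a + 1, b + 1)`. Composing the two gives an order on sort `i`. -/
theorem C1.of_slice (hc : ∀ i a, Z.R1 i (· = a)) (h : Z.R3 i j l R) (h₀₀ : ¬ R a b c)
    (h₁₁ : ¬ R (a + 1) (b + 1) c) (h₁₀ : R (a + 1) b c) (h₀₁ : R a (b + 1) c)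
    (h₀ : R a b (c + 1)) (h₁ : ¬ R (a + 1) (b + 1) (c + 1)) : Z.C1 i := by
  have key : Z.R2 i i fun x y => x = a ∨ y = a + 1 := by
    refine rel_congr (P := fun x => ∃ q r r', R (x 0) q r ∧ R (x 1) q r' ∧ r' = c)
      (Z.ex j (Z.ex l (Z.ex l (Z.and (h.atom (some (some (some 0))) (some (some none)) (some none)
        rfl rfl rfl) (Z.and (h.atom (some (some (some 1))) (some (some none)) none rfl rfl rfl)
          ((hc l c).atom none rfl)))))) fun x => ?_
    generalize x 0 = u, x 1 = v
    clear h hc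
    revert u v
    rcases bit_eq_or a with rfl | rfl <;> rcases bit_eq_or b with rfl | rfl <;>
      rcases bit_eq_or c with rfl | rfl <;>
      simp_all [forall_bit, exists_bit, bit_one_add_one]
  rcases bit_eq_or a with rfl | rfl
  · exact key
  · exact rel_congr key.swap fun _ => or_comm

/-- At `c` a common neighbour `w` forces equality. At `c + 1` the slice has at least three of the
four points, so any two elements have a common neighbour. -/
theorem C2.of_slice (h : Z.R3 i j l R) (h₀₀ : ¬ R a b c)
    (h₁₁ : ¬ R (a + 1) (b + 1) c) (h₁₀ : R (a + 1) b c) (h₀₁ : R a (b + 1) c)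
    (h₀ : R a b (c + 1)) (h₁ : (R (a + 1) (b + 1) (c + 1) ∧ (R (a + 1) b (c + 1) ∨
      R a (b + 1) (c + 1))) ∨ (R (a + 1) b (c + 1) ∧ R a (b + 1) (c + 1))) :
    Z.C2 i l (c + 1) := by
  refine rel_congr (P := fun x => ∃ w, R (x 0) w (x 2) ∧ R (x 1) w (x 2))
    (Z.ex j (Z.and (h.atom (some 0) none (some 2) rfl rfl rfl)
      (h.atom (some 1) none (some 2) rfl rfl rfl))) fun x => ?_
  generalize x 0 = u, x 1 = v, x 2 = w
  clear h
  revert u v w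
  rcases bit_eq_or a with rfl | rfl <;> rcases bit_eq_or b with rfl | rfl <;>
    rcases bit_eq_or c with rfl | rfl <;>
    simp_all [forall_bit, exists_bit, bit_one_add_one] <;> tauto

theorem C5.of_slices (h : Z.R3 i j l R) (h₀₀ : ¬ R a b c)
    (h₁₁ : ¬ R (a + 1) (b + 1) c) (h₁₀ : R (a + 1) b c) (h₀₁ : R a (b + 1) c)
    (h₀ : R a b (c + 1)) (h₁ : R (a + 1) (b + 1) (c + 1)) (h₂ : ¬ R (a + 1) b (c + 1))
    (h₃ : ¬ R a (b + 1) (c + 1)) : Z.C5 i j ∧ Z.C5 i l := by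
  have key : ∀ x y z, R x y z ↔ x + y + z = a + b + c + 1 := by
    clear h
    rcases bit_eq_or a with rfl | rfl <;> rcases bit_eq_or b with rfl | rfl <;>
      rcases bit_eq_or c with rfl | rfl <;>
      simp_all [forall_bit, bit_one_add_one]
  have h' : Z.R3 i j l fun x y z => x + y + z = a + b + c + 1 := rel_congr h fun x => key _ _ _
  constructor
  · refine rel_congr (P := fun x => ∃ w, x 0 + x 2 + w = a + b + c + 1 ∧
        x 1 + x 3 + w = a + b + c + 1)
      (Z.ex l (Z.and (h'.atom (some 0) (some 2) none rfl rfl rfl)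
        (h'.atom (some 1) (some 3) none rfl rfl rfl))) fun x => ?_
    generalize x 0 = u, x 1 = v, x 2 = w, x 3 = y, a + b + c + 1 = d
    clear * -
    revert u v w y d
    decide
  · refine rel_congr (P := fun x => ∃ w, x 0 + w + x 2 = a + b + c + 1 ∧
        x 1 + w + x 3 = a + b + c + 1)
      (Z.ex j (Z.and (h'.atom (some 0) none (some 2) rfl rfl rfl)
        (h'.atom (some 1) none (some 3) rfl rfl rfl))) fun x => ?_
    generalize x 0 = u, x 1 = v, x 2 = w, x 3 = y, a + b + c + 1 = d
    clear * -
    revert u v w y d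
    decide

/-- When the hypothesis of `C2.of_slice` fails, fixing the first or the second coordinate leaves the
graph of a bijection; this identifies sort `i` with sort `l`, directly or through `j`, and
transports `C3`. -/
theorem C3.of_slice (hc : ∀ i a, Z.R1 i (· = a)) (hi : Z.C3 i i) (h : Z.R3 i j l R)
    (h₀₀ : ¬ R a b c)
    (h₁₁ : ¬ R (a + 1) (b + 1) c) (h₁₀ : R (a + 1) b c) (h₀₁ : R a (b + 1) c)
    (h₀ : R a b (c + 1)) (h₁ : ¬ ((R (a + 1) (b + 1) (c + 1) ∧ (R (a + 1) b (c + 1) ∨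
      R a (b + 1) (c + 1))) ∨ (R (a + 1) b (c + 1) ∧ R a (b + 1) (c + 1)))) : Z.C3 i l := by
  by_cases h₂ : R (a + 1) b (c + 1)
  · have h₃ : ¬ R a (b + 1) (c + 1) := by tauto
    have hj : Z.R2 i j fun x y => R x y c := rel_congr
      (P := fun x => ∃ w, R (x 0) (x 1) w ∧ w = c)
      (Z.ex l (Z.and (h.atom (some 0) (some 1) none rfl rfl rfl) ((hc l c).atom none rfl)))
      fun x => by simp
    have hl : Z.R2 j l fun x y => R a x y := rel_congr
      (P := fun x => ∃ w, R w (x 0) (x 1) ∧ w = a)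
      (Z.ex i (Z.and (h.atom none (some 0) (some 1) rfl rfl rfl) ((hc i a).atom none rfl)))
      fun x => by simp
    refine hi.of_iso (c := a + c) (rel_congr
      (P := fun x => ∃ w, x 0 = w + (a + b + 1) ∧ w = x 1 + (b + c + 1))
      (Z.ex j (Z.and ((iso_of_anti hj h₀₀ h₁₁ h₁₀ h₀₁).atom (some 0) none rfl rfl)
        ((iso_of_anti hl h₀₀ h₃ h₀₁ h₀).atom none (some 1) rfl rfl)))
      fun x => ?_)
    generalize x 0 = u, x 1 = v
    clear * -
    revert a b c u v
    decide
  · have hl : Z.R2 i l fun x y => R x b y := rel_congr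
      (P := fun x => ∃ w, R (x 0) w (x 1) ∧ w = b)
      (Z.ex j (Z.and (h.atom (some 0) none (some 1) rfl rfl rfl) ((hc j b).atom none rfl)))
      fun x => by simp
    exact hi.of_iso (iso_of_anti hl h₀₀ h₂ h₁₀ h₀)

end Slices

end QClone

/-! ### Critical predicates -/

namespace QClone

variable {k : ℕ}

/-- Every canonical predicate of `D` belongs to `E`. -/
structure CanonLE (D E : QClone k) : Prop where
  c1 : ∀ i, D.C1 i → E.C1 i
  c2 : ∀ i j b, D.C2 i j b → E.C2 i j b
  c3 : ∀ i j, D.C3 i j → E.C3 i j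
  c4 : ∀ i, D.R2 i i (fun x y => x + y = 1) → E.R2 i i fun x y => x + y = 1
  c5 : ∀ i j, D.C5 i j → E.C5 i j
  c6 : ∀ (n : ℕ) (s : Fin n → Fin k) (b : ZMod 2), 2 ≤ n → Function.Injective s →
    D.rel s (fun x => ∑ p, x p = b) → E.rel s fun x => ∑ p, x p = b
  c7 : ∀ (n : ℕ) (s : Fin n → Fin k) (b : Fin k → ZMod 2),
    D.rel s (fun x => ∃ p, x p = b (s p)) → E.rel s fun x => ∃ p, x p = b (s p)

section Inv

variable {m : Type} [Nonempty m] {f : Fin k → (m → ZMod 2) → ZMod 2}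
  {hf : ∀ i, Function.Surjective (f i)} {i j l n : Fin k}

theorem R2.inv_apply {P} (h : (inv f hf).R2 i j P) (x y : m → ZMod 2) (hxy : ∀ t, P (x t) (y t)) :
    P (f i x) (f j y) :=
  h (fun t => ![x t, y t]) hxy

theorem R3.inv_apply {P} (h : (inv f hf).R3 i j l P) (x y z : m → ZMod 2)
    (hxy : ∀ t, P (x t) (y t) (z t)) : P (f i x) (f j y) (f l z) :=
  h (fun t => ![x t, y t, z t]) hxy

theorem R4.inv_apply {P} (h : (inv f hf).R4 i j l n P) (x y z w : m → ZMod 2)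
    (hxy : ∀ t, P (x t) (y t) (z t) (w t)) : P (f i x) (f j y) (f l z) (f n w) :=
  h (fun t => ![x t, y t, z t, w t]) hxy

end Inv

theorem of_update_closed {ι : Type} [Finite ι] [DecidableEq ι] {P : (ι → ZMod 2) → Prop}
    (K : Set ι) (hP : ∀ p ∈ K, ∀ x a, P x → P (Function.update x p a)) {x y : ι → ZMod 2}
    (hxy : ∀ p ∉ K, x p = y p) (hx : P x) : P y := by
  classical
  have := Fintype.ofFinite ι
  have key : ∀ F : Finset ι, (∀ p ∈ F, p ∈ K) → P (F.piecewise y x) := by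
    intro F
    induction F using Finset.induction_on with
    | empty => simpa using hx
    | insert p F _ ih =>
      intro hF
      rw [Finset.piecewise_insert]
      exact hP p (hF p (by simp)) _ _ (ih fun q hq => hF q (by simp [hq]))
  convert key (Finset.univ.filter (· ∈ K)) (by simp) using 1
  funext p
  by_cases hp : p ∈ K <;> simp [Finset.piecewise, hp, hxy]

/-- `ρ` is a maximal predicate of `D` that avoids the image `α` of the matrix `M` of elements of
`ρ`, and the arity of `ρ` is minimal. -/
structure Critical (D : QClone k) {m : Type} [Nonempty m] (f : Fin k → (m → ZMod 2) → ZMod 2)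
    (hf : ∀ i, Function.Surjective (f i)) {ι : Type} [Finite ι] (s : ι → Fin k)
    (ρ : (ι → ZMod 2) → Prop) (α : ι → ZMod 2) (M : m → ι → ZMod 2) : Prop where
  rel : D.rel s ρ
  rows : ∀ t, ρ (M t)
  image : ∀ p, f (s p) (fun t => M t p) = α p
  not_mem : ¬ ρ α
  max : ∀ σ, D.rel s σ → (∀ x, ρ x → σ x) → ¬ σ α → ∀ x, σ x → ρ x
  ih : ∀ {κ : Type} [Finite κ] (s' : κ → Fin k) (P : (κ → ZMod 2) → Prop),
    Nat.card κ < Nat.card ι → D.rel s' P → (inv f hf).rel s' P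
  canon : CanonLE D (inv f hf)

namespace Critical

variable {D : QClone k} {m : Type} [Nonempty m] {f : Fin k → (m → ZMod 2) → ZMod 2}
  {hf : ∀ i, Function.Surjective (f i)} {ι : Type} [Finite ι] {s : ι → Fin k}
  {ρ : (ι → ZMod 2) → Prop} {α : ι → ZMod 2} {M : m → ι → ZMod 2}

/-- Projecting to `C` loses nothing and lowers the arity, so the minimality hypothesis applies. -/
theorem inv_of_indep (h : Critical D f hf s ρ α M) {P : (ι → ZMod 2) → Prop} (hP : D.rel s P)
    (C : Set ι) {r : ι} (hr : r ∉ C) (hC : ∀ x y, (∀ p ∈ C, x p = y p) → P x → P y) :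
    (inv f hf).rel s P := by
  intro N hN
  have h₁ : D.rel (fun p : C => s p) fun y => ∃ x : ι → ZMod 2, (∀ p : C, x p = y p) ∧ P x := by
    refine ex_sum s (D.and (iInter fun p => D.eq' (Sum.inr p.1) (Sum.inl p) rfl) ?_)
    exact D.subst (s' := Sum.elim (fun p : C => s p) s) Sum.inr (fun _ => rfl) hP
  have h₂ := h.ih _ _ (Finite.card_subtype_lt (p := (· ∈ C)) hr) h₁ (fun t p => N t p)
    fun t => ⟨N t, fun _ => rfl, hN t⟩
  obtain ⟨x, hx, hPx⟩ := h₂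
  exact hC x _ (fun p hp => hx ⟨p, hp⟩) hPx

variable [DecidableEq ι]

theorem inv_of_indep_update (h : Critical D f hf s ρ α M) {P : (ι → ZMod 2) → Prop}
    (hP : D.rel s P) (r : ι) (hr : ∀ x a, P x → P (Function.update x r a)) :
    (inv f hf).rel s P :=
  h.inv_of_indep hP {r}ᶜ (r := r) (by simp) fun x y hxy hx =>
    of_update_closed {r} (by simpa using hr) (by simpa using hxy) hx

/-- Quantifying `p` existentially gives a preserved predicate, so `α` can be corrected at `p` alone.
-/
theorem flip_mem (h : Critical D f hf s ρ α M) (p : ι) :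
    ρ (Function.update α p (α p + 1)) := by
  obtain ⟨a, ha⟩ := h.inv_of_indep_update (ex_update p h.rel) p (by simp) M
    fun t => ⟨M t p, by simpa using h.rows t⟩
  simp only [h.image] at ha
  by_cases hap : a = α p
  · subst hap
    simp [h.not_mem] at ha
  · rwa [← bit_eq_add_one hap]

/-- Composing `ρ` with a reflexive `θ` at coordinate `p` weakens `ρ`. As `θ` does not lead back to
`α`, the weakening avoids `α`, and maximality makes it equal to `ρ`. -/
theorem closed_one (h : Critical D f hf s ρ α M) (p : ι) {θ : ZMod 2 → (ι → ZMod 2) → Prop}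
    (hθ : D.rel (fun o : Option ι => o.elim (s p) s) fun y => θ (y none) fun t => y (some t))
    (hrefl : ∀ x, θ (x p) x) (hα : ¬ θ (α p + 1) α) {x : ι → ZMod 2} {a : ZMod 2} (hx : ρ x)
    (hxa : θ (x p) (Function.update x p a)) : ρ (Function.update x p a) := by
  refine h.max (fun x => ∃ y, ρ (Function.update x p y) ∧ θ y x)
    (D.ex (s p) (D.and (rel_option_update p h.rel) hθ)) (fun x hx => ⟨x p, by simpa, hrefl x⟩) ?_ _
    ⟨x p, by simpa, hxa⟩
  rintro ⟨y, h₁, h₂⟩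
  by_cases hy : y = α p
  · subst hy
    exact h.not_mem (by simpa using h₁)
  · rw [bit_eq_add_one hy] at h₂
    exact hα h₂

theorem closed_of_C2 (h : Critical D f hf s ρ α M) {p r : ι} (hpr : p ≠ r)
    (h2 : D.C2 (s p) (s r) (α r + 1)) (x : ι → ZMod 2) (a : ZMod 2) (hxr : x r ≠ α r)
    (hx : ρ x) : ρ (Function.update x p a) := by
  refine h.closed_one p (θ := fun y x => y = x p ∨ x r = α r + 1)
    (h2.atom none (some p) (some r) rfl rfl rfl) (fun x => .inl rfl) ?_ hx (.inr ?_)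
  · simp
  · simp [hpr.symm, bit_eq_add_one hxr]

theorem closed_of_C5 (h : Critical D f hf s ρ α M) {p r : ι} (hpr : p ≠ r)
    (h5 : D.C5 (s p) (s r))
    (hα : ¬ ρ (Function.update (Function.update α p (α p + 1)) r (α r + 1)))
    (x : ι → ZMod 2) (hx : ρ x) :
    ρ (Function.update (Function.update x p (x p + 1)) r (x r + 1)) := by
  refine h.max (fun x => ∃ y z, ρ (Function.update (Function.update x p y) r z) ∧
      x p + y = x r + z) ?_ (fun x hx => ⟨x p, x r, by simpa, ?_⟩) ?_ _ ⟨x p, x r, ?_⟩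
  · refine D.ex (s p) (D.ex (s r) (D.and ?_
      (h5.atom (some (some p)) (some none) (some (some r)) none rfl rfl rfl rfl)))
    refine rel_congr (rel_option_update (some r) (rel_option_update p h.rel)) fun y => ?_
    refine iff_of_eq (congrArg ρ (funext fun t => ?_))
    by_cases ht : t = p
    · subst ht
      simp [hpr]
    · by_cases ht' : t = r
      · subst ht'
        simp [ht]
      · simp [ht, ht']
  · simp [CharTwo.add_self_eq_zero]
  · rintro ⟨y, z, h₁, h₂⟩
    by_cases hy : y = α p
    · subst hy
      rw [CharTwo.add_self_eq_zero, eq_comm, CharTwo.add_eq_zero] at h₂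
      subst h₂
      exact h.not_mem (by simpa using h₁)
    · have hy' := bit_eq_add_one hy
      have hz : z = α r + 1 := by
        generalize α p = a, α r = b at *
        clear * - h₂ hy'
        revert a b y z
        decide
      exact hα (by rwa [hy', hz] at h₁)
  · rw [Function.update_comm hpr, Function.update_idem, Function.update_comm hpr.symm,
      Function.update_idem]
    simp [hpr, hx]
    generalize x p = a, x r = b
    clear * -
    revert a b
    decide

/-- Coordinates outside `C` are eliminated one at a time, keeping the behaviour of `ρ` on `C` where
the rest equals `α`. -/
theorem exists_restrict (h : Critical D f hf s ρ α M) (C : Set ι)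
    (hC : ∀ p ∈ C, ∀ r ∉ C, ∀ x a, x r ≠ α r → ρ x → ρ (Function.update x p a)) :
    ∃ P, D.rel s P ∧ (∀ x y, (∀ p ∈ C, x p = y p) → P x → P y) ∧
      ∀ x, (∀ p ∉ C, x p = α p) → (P x ↔ ρ x) := by
  classical
  have := Fintype.ofFinite ι
  have key : ∀ W : Finset ι, (∀ r ∈ W, r ∉ C) → ∃ P, D.rel s P ∧
      (∀ r ∈ W, ∀ x a, P x → P (Function.update x r a)) ∧
      (∀ x, (∀ p ∉ C, p ∉ W → x p = α p) → (P x ↔ ρ fun p => if p ∈ C then x p else α p)) ∧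
      ∀ p ∈ C, ∀ r ∉ C, r ∉ W → ∀ x a, x r ≠ α r → P x → P (Function.update x p a) := by
    intro W
    induction W using Finset.induction_on with
    | empty =>
      refine fun _ => ⟨ρ, h.rel, by simp, fun x hx => ?_, fun p hp r hr _ => hC p hp r hr⟩
      refine iff_of_eq (congrArg ρ (funext fun p => ?_))
      split_ifs with hp
      · rfl
      · exact hx p hp (by simp)
    | insert r W hrW ih =>
      intro hW
      have hr : r ∉ C := hW r (by simp)
      obtain ⟨P, hP, h₁, h₂, h₃⟩ := ih fun q hq => hW q (by simp [hq])
      have hv : ∀ x y : ι → ZMod 2, (∀ p ∉ C, p ∉ W → x p = y p) → x r ≠ α r → P x → P y := by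
        intro x y hxy hxr hx
        refine (of_update_closed (P := fun x => x r ≠ α r ∧ P x) (C ∪ W) ?_ (by simpa using hxy)
          ⟨hxr, hx⟩).2
        rintro p (hp | hp) x a ⟨hx₁, hx₂⟩
        · have hpr : r ≠ p := fun e => hr (e ▸ hp)
          exact ⟨by simpa [hpr] using hx₁, h₃ p hp r hr hrW _ _ hx₁ hx₂⟩
        · have hpr : r ≠ p := fun e => hrW (e ▸ hp)
          exact ⟨by simpa [hpr] using hx₁, h₁ p hp _ _ hx₂⟩
      have hglue : ∀ x : ι → ZMod 2, (∀ p ∉ C, p ∉ insert r W → x p = α p) →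
          (P (Function.update x r (α r)) ↔ ρ fun p => if p ∈ C then x p else α p) := by
        intro x hx
        rw [h₂]
        · refine iff_of_eq (congrArg ρ (funext fun p => ?_))
          split_ifs with hp
          · have hpr : p ≠ r := fun e => hr (e ▸ hp)
            rw [Function.update_of_ne hpr]
          · rfl
        · intro p hp hpW
          by_cases hpr : p = r
          · subst hpr; simp
          · simp [hpr, hx p hp (by simp [hpr, hpW])]
      have hne : ∀ p ∈ C, p ≠ r := fun p hp e => hr (e ▸ hp)
      have hne' : ∀ p ∈ W, p ≠ r := fun p hp e => hrW (e ▸ hp)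
      -- With the remaining outer coordinates at `α`, the half `x r ≠ α r` has a constant truth
      -- value. If it is true, `∀` keeps the half `x r = α r`; if it is false, `∃` does.
      by_cases hfull : P (Function.update α r (α r + 1))
      · refine ⟨_, all_update r hP, ?_, fun x hx => ?_, ?_⟩
        · intro q hq x a hx b
          by_cases hqr : q = r
          · subst hqr; simpa using hx b
          · rw [Function.update_comm hqr]
            exact h₁ q (by simpa [hqr] using hq) _ _ (hx b)
        · rw [forall_bit_of (α r), hglue x hx, and_iff_left]
          refine hv _ _ (fun p hp hpW => ?_) (by simp) hfull
          by_cases hpr : p = r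
          · subst hpr; simp
          · simp [hpr, hx p hp (by simp [hpr, hpW])]
        · intro p hp q hq hqW x a hxq hx b
          rw [Function.update_comm (hne p hp)]
          have hqr : q ≠ r := fun e => hqW (by simp [e])
          exact h₃ p hp q hq (fun e => hqW (by simp [e])) _ _ (by simpa [hqr]) (hx b)
      · refine ⟨_, ex_update r hP, ?_, fun x hx => ?_, ?_⟩
        · rintro q hq x a ⟨b, hx⟩
          refine ⟨b, ?_⟩
          by_cases hqr : q = r
          · subst hqr; simpa using hx
          · rw [Function.update_comm hqr]
            exact h₁ q (by simpa [hqr] using hq) _ _ hx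
        · rw [exists_bit_of (α r), hglue x hx, or_iff_left]
          refine fun hx' => hfull (hv _ _ (fun p hp hpW => ?_) (by simp) hx')
          by_cases hpr : p = r
          · subst hpr; simp
          · simp [hpr, hx p hp (by simp [hpr, hpW])]
        · rintro p hp q hq hqW x a hxq ⟨b, hx⟩
          refine ⟨b, ?_⟩
          rw [Function.update_comm (hne p hp)]
          have hqr : q ≠ r := fun e => hqW (by simp [e])
          exact h₃ p hp q hq (fun e => hqW (by simp [e])) _ _ (by simpa [hqr]) hx
  obtain ⟨P, hP, h₁, h₂, -⟩ := key (Finset.univ.filter (· ∉ C)) (by simp)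
  refine ⟨P, hP, fun x y hxy => ?_, fun x hx => ?_⟩
  · exact of_update_closed Cᶜ (fun p hp => h₁ p (by simpa using hp)) (by simpa using hxy)
  · rw [h₂ x fun p hp hp' => by simp [hp] at hp']
    refine iff_of_eq (congrArg ρ (funext fun p => ?_))
    split_ifs with hp
    · rfl
    · exact (hx p hp).symm

/-- A critical predicate cannot be split by predicates `C2`. -/
theorem false_of_C2 (h : Critical D f hf s ρ α M) (C : Set ι) {p₀ r₀ : ι} (hp₀ : p₀ ∈ C)
    (hr₀ : r₀ ∉ C) (h2 : ∀ p ∈ C, ∀ r ∉ C, D.C2 (s p) (s r) (α r + 1)) : False := by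
  classical
  have := Fintype.ofFinite ι
  obtain ⟨P, hP, h₁, h₂⟩ := h.exists_restrict C fun p hp r hr =>
    h.closed_of_C2 (fun e => hr (e ▸ hp)) (h2 p hp r hr)
  -- On sorts of `C` the operations ignore rows that differ from `α` outside `C`: apply the
  -- preserved `C2` to the column `r`, whose image `α r` rules out the second alternative.
  have hfeq : ∀ p ∈ C, ∀ x y : m → ZMod 2, (∀ t, (∀ r ∉ C, M t r = α r) → x t = y t) →
      f (s p) x = f (s p) y := by
    intro p hp
    have key : ∀ W : Finset ι, (∀ r ∈ W, r ∉ C) → ∀ x y : m → ZMod 2,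
        (∀ t, (∀ r ∈ W, M t r = α r) → x t = y t) → f (s p) x = f (s p) y := by
      intro W
      induction W using Finset.induction_on with
      | empty => exact fun _ x y hxy => congrArg _ (funext fun t => hxy t (by simp))
      | insert r W hrW ih =>
        intro hW x y hxy
        let z : m → ZMod 2 := fun t => if M t r = α r then x t else y t
        have h₃ : f (s p) x = f (s p) z := by
          refine (R3.inv_apply (h.canon.c2 _ _ _ (h2 p hp r (hW r (by simp)))) x z
            (fun t => M t r) fun t => ?_).resolve_right ?_
          · by_cases ht : M t r = α r
            · simp [z, ht]
            · exact .inr (bit_eq_add_one ht)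
          · rw [h.image]
            exact (bit_add_one_ne _).symm
        rw [h₃]
        refine ih (fun q hq => hW q (by simp [hq])) z y fun t ht => ?_
        by_cases htr : M t r = α r
        · simp only [z, htr, if_true]
          refine hxy t fun q hq => ?_
          rcases Finset.mem_insert.1 hq with rfl | hq
          · exact htr
          · exact ht q hq
        · simp [z, htr]
    intro x y hxy
    exact key (Finset.univ.filter (· ∉ C)) (by simp) x y fun t ht => hxy t (by simpa using ht)
  obtain ⟨t₀, ht₀⟩ : ∃ t₀, ∀ r ∉ C, M t₀ r = α r := by
    by_contra hcon
    push Not at hcon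
    have hconst : ∀ x y, f (s p₀) x = f (s p₀) y := fun x y =>
      hfeq p₀ hp₀ x y fun t ht => by
        obtain ⟨r, hr, hr'⟩ := hcon t
        exact absurd (ht r hr) hr'
    obtain ⟨x, hx⟩ := hf (s p₀) 0
    obtain ⟨y, hy⟩ := hf (s p₀) 1
    have := hconst x y
    rw [hx, hy] at this
    exact absurd this (by decide)
  -- The ignored rows are replaced by a relevant one, so all rows satisfy `P` and the image on `C`
  -- is unchanged.
  let N : m → ι → ZMod 2 := fun t => if ∀ r ∉ C, M t r = α r then M t else M t₀
  have hN : ∀ t, P (N t) := by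
    intro t
    by_cases ht : ∀ r ∉ C, M t r = α r
    · simp only [N, if_pos ht]
      exact (h₂ _ ht).2 (h.rows t)
    · simp only [N, if_neg ht]
      exact (h₂ _ ht₀).2 (h.rows t₀)
  have := h.inv_of_indep hP C hr₀ h₁ N hN
  refine h.not_mem ((h₂ α fun _ _ => rfl).1 (h₁ _ _ (fun p hp => ?_) this))
  rw [← h.image p]
  exact hfeq p hp _ _ fun t ht => by simp [N, if_pos ht]

end Critical

end QClone

/-! ### Minimal gaps, and the two basic shapes of a critical predicate -/

namespace QClone

variable {k : ℕ}

/-- `β` is a non-member of `ρ`, and every other point of the interval between `α` and `β`, except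
for `α`, belongs to `ρ`. -/
structure IsMinimalGap {ι : Type} (ρ : (ι → ZMod 2) → Prop) (α β : ι → ZMod 2) : Prop where
  ne : β ≠ α
  not_mem : ¬ ρ β
  between : ∀ x, (∀ j, x j = α j ∨ x j = β j) → x ≠ α → x ≠ β → ρ x

theorem IsMinimalGap.mem {ι : Type} {ρ : (ι → ZMod 2) → Prop} {α β x : ι → ZMod 2}
    (h : IsMinimalGap ρ α β) (hx : ∀ j, x j = α j ∨ x j = β j) (p q : ι) (hp : x p ≠ α p)
    (hq : x q ≠ β q) : ρ x :=
  h.between x hx (fun e => hp (congrFun e p)) fun e => hq (congrFun e q)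

section Gap

variable {ι : Type} {ρ : (ι → ZMod 2) → Prop} {α β : ι → ZMod 2}

theorem IsMinimalGap.update_mem [DecidableEq ι] (hβ : IsMinimalGap ρ α β) {p q : ι} (hpq : p ≠ q)
    (hp : β p ≠ α p) (hq : β q ≠ α q) :
    ρ (Function.update (Function.update β p (α p + 1)) q (α q)) ∧
      ρ (Function.update (Function.update β p (α p)) q (α q + 1)) := by
  constructor
  · refine hβ.mem (fun j => ?_) p q (by simp [hpq]) (by simpa using hq.symm)
    by_cases hj : j = q
    · subst hj; simp
    by_cases hj' : j = p
    · subst hj'; simp [hj, bit_eq_add_one hp]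
    simp [hj, hj']
  · refine hβ.mem (fun j => ?_) q p (by simp) (by simpa [hpq] using hp.symm)
    by_cases hj : j = q
    · subst hj; simp [bit_eq_add_one hq]
    by_cases hj' : j = p
    · subst hj'; simp [hj]
    simp [hj, hj']

theorem IsMinimalGap.update_not_mem [DecidableEq ι] (hβ : IsMinimalGap ρ α β) {p q : ι}
    (hp : β p ≠ α p) (hq : β q ≠ α q) :
    ¬ ρ (Function.update (Function.update β p (α p + 1)) q (α q + 1)) := by
  rw [← bit_eq_add_one hp, ← bit_eq_add_one hq]
  simpa using hβ.not_mem

end Gap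

theorem exists_isMinimalGap {ι : Type} [Finite ι] {ρ : (ι → ZMod 2) → Prop}
    {α γ : ι → ZMod 2} (hγ : γ ≠ α) (h : ¬ ρ γ) :
    ∃ β, IsMinimalGap ρ α β ∧ ∀ j, β j = α j ∨ β j = γ j := by
  classical
  have := Fintype.ofFinite ι
  induction hn : (Finset.univ.filter fun j => γ j ≠ α j).card using Nat.strong_induction_on
    generalizing γ with
  | _ n ih =>
  by_cases hmin : ∀ x, (∀ j, x j = α j ∨ x j = γ j) → x ≠ α → x ≠ γ → ρ x
  · exact ⟨γ, ⟨hγ, h, hmin⟩, fun j => .inr rfl⟩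
  · push Not at hmin
    obtain ⟨x, hx, hxα, hxγ, hxρ⟩ := hmin
    have hlt : (Finset.univ.filter fun j => x j ≠ α j).card < n := by
      rw [← hn]
      refine Finset.card_lt_card ⟨fun j => ?_, fun hsub => hxγ (funext fun j => ?_)⟩
      · simp only [Finset.mem_filter, Finset.mem_univ, true_and]
        intro hj
        rcases hx j with h | h
        · exact absurd h hj
        · exact h ▸ hj
      · have := @hsub j
        simp only [Finset.mem_filter, Finset.mem_univ, true_and] at this
        rcases hx j with h | h
        · by_contra hne
          exact this (fun e => hne (h.trans e.symm)) h
        · exact h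
    obtain ⟨β, hβ, hβx⟩ := ih _ hlt hxα hxρ rfl
    refine ⟨β, hβ, fun j => ?_⟩
    rcases hβx j with h | h
    · exact .inl h
    · exact h ▸ hx j

namespace Critical

variable {D Z : QClone k} {m : Type} [Nonempty m] {f : Fin k → (m → ZMod 2) → ZMod 2}
  {hf : ∀ i, Function.Surjective (f i)} {ι : Type} [Finite ι] {s : ι → Fin k}
  {ρ : (ι → ZMod 2) → Prop} {α β : ι → ZMod 2} {M : m → ι → ZMod 2}

section Gap

variable [DecidableEq ι]

theorem exists_ne (h : Critical D f hf s ρ α M) (hβ : IsMinimalGap ρ α β) (p : ι) :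
    ∃ q, q ≠ p ∧ β q ≠ α q := by
  by_contra hcon
  push Not at hcon
  by_cases hp : β p = α p
  · exact hβ.ne (funext fun q => if hq : q = p then hq ▸ hp else hcon q hq)
  · refine hβ.not_mem ?_
    convert h.flip_mem p using 1
    funext q
    by_cases hq : q = p
    · subst hq; simp [bit_eq_add_one hp]
    · simp [hq, hcon q hq]

theorem flip_mem_left (h : Critical D f hf s ρ α M) {p q : ι} (hpq : p ≠ q) :
    ρ (Function.update (Function.update α p (α p + 1)) q (α q)) := by
  rw [Function.update_comm hpq]
  simpa using h.flip_mem p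

theorem flip_mem_right (h : Critical D f hf s ρ α M) (p q : ι) :
    ρ (Function.update (Function.update α p (α p)) q (α q + 1)) := by
  simpa using h.flip_mem q

/-- In the conjunction of the slices through `α` and through `β`, one excludes the corner `α`, the
other the opposite corner, and the two mixed corners survive. -/
theorem iso_of_gap (h : Critical D f hf s ρ α M) (hDZ : D ≤ Z) (hc : ∀ i a, Z.R1 i (· = a))
    (hβ : IsMinimalGap ρ α β) {p q : ι} (hpq : p ≠ q) (hp : β p ≠ α p) (hq : β q ≠ α q) :
    Z.R2 (s p) (s q) fun x y => x = y + (α p + α q + 1) := by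
  refine iso_of_anti (P := fun u v => ρ (Function.update (Function.update α p u) q v) ∧
    ρ (Function.update (Function.update β p u) q v)) (Z.and (slice_two hc (hDZ h.rel) α hpq) (slice_two hc (hDZ h.rel) β hpq))
    ?_ ?_ ?_ ?_
  · simp [h.not_mem]
  · exact fun h' => hβ.update_not_mem hp hq h'.2
  · exact ⟨h.flip_mem_left hpq, (hβ.update_mem hpq hp hq).1⟩
  · exact ⟨h.flip_mem_right p q, (hβ.update_mem hpq hp hq).2⟩

theorem C3_of_three (h : Critical D f hf s ρ α M) (hβ : IsMinimalGap ρ α β) {p q r : ι}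
    (hpq : p ≠ q) (hpr : p ≠ r) (hqr : q ≠ r) (hp : β p ≠ α p) (hq : β q ≠ α q)
    (hr : β r ≠ α r) : D.C3 (s p) (s p) := by
  obtain ⟨Z, hDZ, hc, -, -, h3, -⟩ := exists_le_const D
  refine h3 _ _ (C3.of_iso_of_nae ?_ (h.iso_of_gap hDZ hc hβ hpq hp hq)
    (h.iso_of_gap hDZ hc hβ hqr hq hr))
  refine rel_congr (Z.and (slice_three hc (hDZ h.rel) α hpq hpr hqr)
    (slice_three hc (hDZ h.rel) β hpq hpr hqr)) fun y => ?_
  generalize y 0 = u, y 1 = v, y 2 = w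
  have hp' := bit_eq_add_one hp
  have hq' := bit_eq_add_one hq
  have hr' := bit_eq_add_one hr
  constructor
  · rintro ⟨h₁, h₂⟩
    constructor
    · rintro ⟨rfl, rfl, rfl⟩
      exact h.not_mem (by simpa using h₁)
    · rintro ⟨rfl, rfl, rfl⟩
      rw [← hp', ← hq', ← hr'] at h₂
      exact hβ.not_mem (by simpa using h₂)
  · rintro ⟨h₁, h₂⟩
    have key : ∀ γ : ι → ZMod 2, (∀ j, γ j = α j ∨ γ j = β j) →
        ρ (Function.update (Function.update (Function.update γ p u) q v) r w) := by
      intro γ hγ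
      refine hβ.between _ (fun j => ?_) (fun e => h₁ ?_) fun e => h₂ ?_
      · by_cases hj : j = r
        · subst hj
          simp only [Function.update_self, hr']
          by_cases hw : w = α j
          · exact .inl hw
          · exact .inr (bit_eq_add_one hw)
        by_cases hj' : j = q
        · subst hj'
          simp only [Function.update_self, Function.update_of_ne hj, hq']
          by_cases hw : v = α j
          · exact .inl hw
          · exact .inr (bit_eq_add_one hw)
        by_cases hj'' : j = p
        · subst hj''
          simp only [Function.update_self, Function.update_of_ne hj, Function.update_of_ne hj', hp']
          by_cases hw : u = α j
          · exact .inl hw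
          · exact .inr (bit_eq_add_one hw)
        simpa [hj, hj', hj''] using hγ j
      · have e₁ := congrFun e p
        have e₂ := congrFun e q
        have e₃ := congrFun e r
        simp [hpq, hpr, hqr] at e₁ e₂ e₃
        exact ⟨e₁, e₂, e₃⟩
      · have e₁ := congrFun e p
        have e₂ := congrFun e q
        have e₃ := congrFun e r
        simp [hpq, hpr, hqr, hp', hq', hr'] at e₁ e₂ e₃
        exact ⟨e₁, e₂, e₃⟩
    exact ⟨key α fun j => .inl rfl, key β fun j => .inr rfl⟩

end Gap

theorem all_three [DecidableEq ι] {P : (ι → ZMod 2) → Prop} (h : D.rel s P) (p q r : ι) :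
    D.R3 (s p) (s q) (s r) fun u v w =>
      ∀ y, P (Function.update (Function.update (Function.update y p u) q v) r w) := by
  refine all_sum s (Q := fun x y => P
    (Function.update (Function.update (Function.update y p (x 0)) q (x 1)) r (x 2))) ?_
  refine rel_congr (D.subst (s' := Sum.elim ![s p, s q, s r] s) (fun t => if t = r then .inl 2 else
    if t = q then .inl 1 else if t = p then .inl 0 else .inr t) (fun t => ?_) h) fun x => ?_
  · split_ifs with h₁ h₂ h₃ <;> simp [*]
  · refine iff_of_eq (congrArg P (funext fun t => ?_))
    simp only [Function.update_apply]
    split_ifs <;> rfl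

/-- A critical predicate omits at least two points. -/
theorem false_of_forall_ne (h : Critical D f hf s ρ α M) (hρ : ∀ x, x ≠ α → ρ x) : False := by
  classical
  have := Fintype.ofFinite ι
  have hρ' : ∀ x, ρ x ↔ ∃ p, x p = α p + 1 := fun x => by
    constructor
    · intro hx
      by_contra hcon
      push Not at hcon
      refine h.not_mem ?_
      convert hx using 1
      funext p
      by_contra hp
      exact hcon p (bit_eq_add_one (Ne.symm hp))
    · rintro ⟨p, hp⟩
      exact hρ x fun e => bit_add_one_ne (α p) (by rw [← hp, e])
  -- If `α` is constant on each sort, `ρ` itself has type (c7).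
  by_cases hmono : ∀ p q, s p = s q → α p = α q
  · obtain ⟨b, hb⟩ : ∃ b : Fin k → ZMod 2, ∀ p, b (s p) = α p + 1 := by
      refine ⟨fun i => if hi : ∃ p, s p = i then α hi.choose + 1 else 0, fun p => ?_⟩
      have hp : ∃ q, s q = s p := ⟨p, rfl⟩
      simp only [dif_pos hp]
      rw [hmono _ _ hp.choose_spec]
    let e := Fintype.equivFin ι
    have h₁ : D.rel (fun p => s (e.symm p)) fun x => ∃ p, x p = b (s (e.symm p)) := by
      refine rel_congr (D.subst (s' := fun p => s (e.symm p)) e (fun p => by simp) h.rel)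
        fun x => ?_
      rw [hρ']
      exact ⟨fun ⟨p, hp⟩ => ⟨e p, by simp [hp, hb]⟩,
        fun ⟨p, hp⟩ => ⟨e.symm p, by simp [hp, hb]⟩⟩
    obtain ⟨p, hp⟩ := h.canon.c7 _ _ b h₁ (fun t p => M t (e.symm p)) fun t => by
      obtain ⟨p, hp⟩ := (hρ' _).1 (h.rows t)
      exact ⟨e p, by simp [hp, hb]⟩
    have hp := (h.image _).symm.trans (hp.trans (hb _))
    exact bit_add_one_ne _ hp.symm
  · push Not at hmono
    obtain ⟨p, q, hs, hp, hq⟩ : ∃ p q, s p = s q ∧ α p = 1 ∧ α q = 0 := by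
      obtain ⟨p, q, hs, hpq⟩ := hmono
      rcases bit_eq_or (α p) with hp | hp <;> rcases bit_eq_or (α q) with hq | hq
      · exact absurd (hp.trans hq.symm) hpq
      · exact ⟨q, p, hs.symm, hq, hp⟩
      · exact ⟨p, q, hs, hp, hq⟩
      · exact absurd (hp.trans hq.symm) hpq
    have hpq : p ≠ q := by
      rintro rfl
      simp [hp] at hq
    by_cases hr : ∃ r, r ≠ p ∧ r ≠ q
    · obtain ⟨r₀, hr₀⟩ := hr
      have key : ∀ r, r ≠ p → r ≠ q → D.C2 (s p) (s r) (α r + 1) := by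
        intro r hrp hrq
        have h₁ : D.R3 (s p) (s p) (s r) fun u v w =>
            ∀ y, ρ (Function.update (Function.update (Function.update y p u) q v) r w) := by
          have := all_three h.rel p q r
          rwa [← hs] at this
        have h₂ : ∀ u v w, (∀ y, ρ (Function.update (Function.update
            (Function.update y p u) q v) r w)) ↔ u = 0 ∨ v = 1 ∨ w = α r + 1 := by
          intro u v w
          constructor
          · intro hy
            obtain ⟨t, ht⟩ := (hρ' _).1 (hy α)
            by_cases htr : t = r
            · subst htr
              exact .inr (.inr (by simpa using ht))
            by_cases htq : t = q
            · subst htq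
              exact .inr (.inl (by simpa [htr, hq] using ht))
            by_cases htp : t = p
            · subst htp
              exact .inl (by simpa [htr, htq, hp, bit_one_add_one] using ht)
            simp [htr, htq, htp] at ht
          · rintro (rfl | rfl | rfl) y
            · exact (hρ' _).2 ⟨p, by simp [hpq, hrp.symm, hp, bit_one_add_one]⟩
            · exact (hρ' _).2 ⟨q, by simp [hrq.symm, hq]⟩
            · exact (hρ' _).2 ⟨r, by simp⟩
        -- Conjunction with the version in which the first two variables are swapped turns `u = 0 ∨
        -- v = 1` into `u = v`.
        refine rel_congr (D.and (R3.atom h₁ 0 1 2 rfl rfl rfl) (R3.atom h₁ 1 0 2 rfl rfl rfl))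
          fun x => ?_
        simp only [h₂]
        generalize x 0 = u, x 1 = v, x 2 = w, α r = a
        clear * -
        revert u v w a
        decide
      refine h.false_of_C2 {p, q} (p₀ := p) (r₀ := r₀) (by simp) (by simp [hr₀]) ?_
      intro p' hp' r hr
      simp only [Set.mem_insert_iff, Set.mem_singleton_iff, not_or] at hp' hr
      rcases hp' with rfl | rfl
      · exact key r hr.1 hr.2
      · rw [← hs]
        exact key r hr.1 hr.2
    · push Not at hr
      have h₁ : D.C1 (s p) := by
        refine rel_congr (D.subst (s' := ![s p, s p]) (fun t => if t = p then 0 else 1)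
          (fun t => ?_) h.rel) fun x => ?_
        · by_cases ht : t = p
          · simp [ht]
          · have := hr t ht
            subst this
            simp [ht, hs]
        · rw [hρ']
          constructor
          · rintro ⟨t, ht⟩
            by_cases htp : t = p
            · subst htp
              exact .inl (by simpa [hp, bit_one_add_one] using ht)
            · have := hr t htp
              subst this
              exact .inr (by simpa [hq, htp] using ht)
          · rintro (h₀ | h₀)
            · exact ⟨p, by simp [h₀, hp, bit_one_add_one]⟩
            · exact ⟨q, by simp [h₀, hq, hpq.symm]⟩
      have h₂ := R2.inv_apply (h.canon.c1 _ h₁) (fun t => M t p) (fun t => M t q) fun t => by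
        obtain ⟨r, hr'⟩ := (hρ' _).1 (h.rows t)
        by_cases htp : r = p
        · subst htp
          exact .inl (by simpa [hp, bit_one_add_one] using hr')
        · have := hr r htp
          subst this
          exact .inr (by simpa [hq] using hr')
      have h₃ := h.image q
      rw [← hs] at h₃
      rw [h.image, h₃, hp, hq] at h₂
      revert h₂
      decide

/-- A critical predicate is not a linear equation with variables of distinct sorts. -/
theorem false_of_parity [Fintype ι] (h : Critical D f hf s ρ α M) (hs : Function.Injective s)
    {d : ZMod 2} (hρ : ∀ x, ρ x ↔ ∑ p, x p = d) : False := by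
  refine h.not_mem ((hρ α).2 ?_)
  rcases Nat.lt_or_ge (Fintype.card ι) 2 with hι | hι
  · rcases Nat.lt_or_ge (Fintype.card ι) 1 with hι' | hι'
    · have : IsEmpty ι := Fintype.card_eq_zero_iff.1 (by lia)
      obtain ⟨t⟩ := ‹Nonempty m›
      rw [Subsingleton.elim α (M t)]
      exact (hρ _).1 (h.rows t)
    -- A linear equation in one variable is a disjunction with a single equation, so (c7) covers it.
    · obtain ⟨p, hp⟩ := Fintype.card_eq_one_iff.1 (show Fintype.card ι = 1 by lia)
      have hsum : ∀ x : ι → ZMod 2, ∑ q, x q = x p := fun x =>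
        Fintype.sum_eq_single p fun q hq => absurd (hp q) hq
      have h₁ : D.rel (fun _ : Fin 1 => s p) fun x => ∃ q, x q = (fun _ => d) (s p) := by
        refine rel_congr (D.subst (s' := fun _ : Fin 1 => s p) (fun _ => 0)
          (fun q => by rw [hp q]) h.rel) fun x => ?_
        rw [hρ, hsum]
        simp
      obtain ⟨q, hq⟩ := h.canon.c7 1 _ (fun _ => d) h₁ (fun t _ => M t p) fun t =>
        ⟨0, (hsum (M t)).symm.trans ((hρ _).1 (h.rows t))⟩
      rw [hsum, ← h.image]
      exact hq
  · let e := Fintype.equivFin ι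
    have h₁ : D.rel (fun p => s (e.symm p)) fun x => ∑ p, x p = d := by
      refine rel_congr (D.subst (s' := fun p => s (e.symm p)) e (fun p => by simp) h.rel)
        fun x => ?_
      rw [hρ, e.sum_comp]
    have h₂ := h.canon.c6 _ _ d hι (hs.comp e.symm.injective) h₁ (fun t p => M t (e.symm p))
      fun t => by
        exact (e.symm.sum_comp (M t)).trans ((hρ _).1 (h.rows t))
    rw [← h₂, ← e.symm.sum_comp]
    exact Finset.sum_congr rfl fun p _ => (h.image _).symm

end Critical

end QClone

/-! ### Critical predicates in the presence of `C3` -/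

namespace QClone

variable {k : ℕ}

/-- Operations that preserve all the relations `C3` depend on one common coordinate. -/
theorem exists_coord {m : Type} [Finite m] [Nonempty m] {f : Fin k → (m → ZMod 2) → ZMod 2}
    {hf : ∀ i, Function.Surjective (f i)} {J : Set (Fin k)} {i : Fin k}
    (h : ∀ j ∈ J, (inv f hf).C3 i j) :
    ∃ (a : m) (c : Fin k → ZMod 2), ∀ j ∈ J, ∀ v, f j v = v a + c j := by
  classical
  obtain ⟨a, x, b, hx⟩ : ∃ a x b, f i x ≠ f i (Function.update x a b) := by
    by_contra hcon
    push Not at hcon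
    obtain ⟨x, hx⟩ := hf i 0
    obtain ⟨y, hy⟩ := hf i 1
    have := of_update_closed (P := fun z => f i z = 0) Set.univ
      (fun p _ z b hz => (hcon p z b).symm.trans hz) (y := y) (by simp) hx
    rw [hy] at this
    exact absurd this (by decide)
  -- The pair `x`, `Function.update x a b` differs at most in row `a`, where `u` and `v` agree, and
  -- `f i` separates it. Preservation of `C3` then forces equality.
  have hdep : ∀ j ∈ J, ∀ u v : m → ZMod 2, u a = v a → f j u = f j v := fun j hj u v huv =>
    (R4.inv_apply (h j hj) x (Function.update x a b) u v fun t => by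
      by_cases ht : t = a
      · subst ht; exact .inr huv
      · simp [ht]).resolve_left hx
  refine ⟨a, fun j => f j fun _ => 0, fun j hj v => ?_⟩
  by_cases hv : v a = 0
  · rw [hv, zero_add]
    exact hdep j hj _ _ hv
  · have hv' : v a = 1 := by simpa using bit_eq_add_one hv
    rw [hv', add_comm]
    refine bit_eq_add_one fun heq => ?_
    have hconst : ∀ u, f j u = f j fun _ => 0 := fun u => by
      by_cases hu : u a = 0
      · exact hdep j hj _ _ hu
      · exact (hdep j hj _ v (by rw [bit_eq_add_one hu, hv', zero_add])).trans heq
    obtain ⟨u, hu⟩ := hf j ((f j fun _ => 0) + 1)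
    exact bit_add_one_ne _ (hu.symm.trans (hconst u))

theorem sum_update_add_one {ι : Type} [Fintype ι] [DecidableEq ι] (x : ι → ZMod 2) (p : ι) :
    ∑ q, Function.update x p (x p + 1) q = ∑ q, x q + 1 := by
  have : Function.update x p (x p + 1) = x + Pi.single p 1 := by
    funext q
    by_cases hq : q = p
    · subst hq; simp
    · simp [hq]
  simp [this, Finset.sum_add_distrib]

theorem of_flip_closed {ι : Type} [Finite ι] [DecidableEq ι] {P : (ι → ZMod 2) → Prop}
    (hP : ∀ p x, P x → P (Function.update x p (x p + 1))) {x : ι → ZMod 2} (hx : P x)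
    (y : ι → ZMod 2) : P y := by
  refine of_update_closed Set.univ (fun p _ z a hz => ?_) (by simp) hx
  by_cases ha : a = z p
  · subst ha; simpa
  · rw [bit_eq_add_one ha]
    exact hP p z hz

namespace Critical

variable {D : QClone k} {m : Type} [Nonempty m] {f : Fin k → (m → ZMod 2) → ZMod 2}
  {hf : ∀ i, Function.Surjective (f i)} {ι : Type} [Finite ι] {s : ι → Fin k}
  {ρ : (ι → ZMod 2) → Prop} {α β : ι → ZMod 2} {M : m → ι → ZMod 2}

/-- All operations are translates of one coordinate, so on tuples they act as a translation `τ` with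
`τ μ = α`. Predicates of `D` that do not depend on some coordinate are closed under `τ`. -/
theorem false_of_shift [Finite m] (h : Critical D f hf s ρ α M) {p₀ : ι}
    (h3 : ∀ q, D.C3 (s p₀) (s q)) : False := by
  classical
  have := Fintype.ofFinite ι
  obtain ⟨a, c, hac⟩ := exists_coord (hf := hf) (J := Set.range s) (i := s p₀)
    (by rintro _ ⟨q, rfl⟩; exact h.canon.c3 _ _ (h3 q))
  simp only [Set.forall_mem_range] at hac
  set μ := M a
  have hμ : ρ μ := h.rows a
  have hα : ∀ p, α p = μ p + c (s p) := fun p => by rw [← h.image, hac]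
  let τ : (ι → ZMod 2) → ι → ZMod 2 := fun x p => x p + c (s p)
  have hττ : ∀ x, τ (τ x) = x := fun x => funext fun p => by
    simp [τ, add_assoc, CharTwo.add_self_eq_zero]
  have hτμ : τ μ = α := funext fun p => (hα p).symm
  have hτu : ∀ x p b, τ (Function.update x p b) = Function.update (τ x) p (b + c (s p)) := by
    intro x p b
    funext q
    by_cases hq : q = p
    · subst hq; simp [τ]
    · simp [τ, hq]
  have hinv : ∀ P : (ι → ZMod 2) → Prop, D.rel s P → ∀ r, (∀ x b, P x → P (Function.update x r b)) →
      ∀ x, P x → P (τ x) := by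
    intro P hP r hr x hx
    have := h.inv_of_indep_update hP r hr (fun _ => x) fun _ => hx
    simpa [hac] using this
  have hex : ∀ p x, ρ x ∨ ρ (Function.update x p (x p + 1)) →
      ρ (τ x) ∨ ρ (Function.update (τ x) p (τ x p + 1)) := by
    intro p x hx
    have := hinv _ (ex_update p h.rel) p (by simp) x
      ((exists_bit_of (x p)).2 (by simpa using hx))
    simpa using (exists_bit_of (τ x p)).1 this
  have hall : ∀ p x, ρ x ∧ ρ (Function.update x p (x p + 1)) →
      ρ (τ x) ∧ ρ (Function.update (τ x) p (τ x p + 1)) := by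
    intro p x hx
    have := hinv _ (all_update p h.rel) p (by simp) x
      ((forall_bit_of (x p)).2 (by simpa using hx))
    simpa using (forall_bit_of (τ x p)).1 this
  have key : ∀ x p, ρ x → ¬ ρ (τ x) → ¬ ρ (Function.update x p (x p + 1)) ∧
      ρ (Function.update (τ x) p (τ x p + 1)) := fun x p h₁ h₂ =>
    ⟨fun h₃ => h₂ (hall p x ⟨h₁, h₃⟩).1, (hex p x (.inl h₁)).resolve_left h₂⟩
  have hτf : ∀ x p, τ (Function.update x p (x p + 1)) =
      Function.update (τ x) p (τ x p + 1) := fun x p => by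
    rw [hτu, add_right_comm]
  -- By `key`, each flip exchanges which of `x` and `τ x` belongs to `ρ`. Starting at `μ`, this
  -- reaches every point and shows that `ρ` is a parity condition.
  have main : ∀ x, (∑ p, x p = ∑ p, μ p ∧ ρ x ∧ ¬ ρ (τ x)) ∨
      (∑ p, x p = ∑ p, μ p + 1 ∧ ¬ ρ x ∧ ρ (τ x)) := by
    refine of_flip_closed (fun p x hx => ?_) (x := μ) (.inl ⟨rfl, hμ, by rw [hτμ]; exact h.not_mem⟩)
    rw [sum_update_add_one, hτf]
    rcases hx with ⟨h₁, h₂, h₃⟩ | ⟨h₁, h₂, h₃⟩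
    · exact .inr ⟨by rw [h₁], key x p h₂ h₃⟩
    · have := key (τ x) p h₃ (by rwa [hττ])
      rw [hττ] at this
      exact .inl ⟨by rw [h₁, add_assoc, CharTwo.add_self_eq_zero, add_zero], this.2, this.1⟩
  have hρ : ∀ x, ρ x ↔ ∑ p, x p = ∑ p, μ p := by
    intro x
    rcases main x with ⟨h₁, h₂, -⟩ | ⟨h₁, h₂, -⟩
    · exact iff_of_true h₂ h₁
    · exact iff_of_false h₂ (by rw [h₁]; exact bit_add_one_ne _)
  refine h.false_of_parity (fun p q hpq => ?_) hρ
  by_contra hne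
  -- Identifying `p` with `q` gives a `τ`-closed predicate, whereas `ρ` contains exactly one of `y`
  -- and `τ y`.
  have hid : ∀ y : ι → ZMod 2, y p = y q → ¬ ρ y := by
    intro y hy hρy
    have h₁ := hinv _ (identify hpq h.rel) p (fun x b hx => by simpa [Ne.symm hne] using hx) y
      (by rw [← hy]; simpa)
    have h₂ : τ y q = τ y p := by simp [τ, hy, hpq]
    rw [h₂, Function.update_eq_self] at h₁
    rcases main y with h₃ | h₃
    · exact h₃.2.2 h₁
    · exact h₃.2.1 hρy
  by_cases hr : ∃ r, r ≠ p ∧ r ≠ q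
  · obtain ⟨r, hrp, hrq⟩ := hr
    have h₁ : ¬ ρ fun _ => 0 := hid _ rfl
    have h₂ := hid (Function.update (fun _ => 0) r (0 + 1)) (by simp [hrp.symm, hrq.symm])
    rw [hρ] at h₁ h₂
    rw [sum_update_add_one (fun _ => 0) r] at h₂
    exact h₂ (bit_eq_add_one (Ne.symm h₁)).symm
  · push Not at hr
    refine h.not_mem ((hρ α).2 ?_)
    have hsum : ∑ t, c (s t) = 0 := by
      rw [Fintype.sum_eq_add p q hne fun t ht => absurd (hr t ht.1) ht.2, hpq,
        CharTwo.add_self_eq_zero]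
    simp [hα, Finset.sum_add_distrib, hsum]

/-- Either every sort is linked to that of `p` by `C3`, the translation case, or the coordinates
linked to `p` are separated from the others by `C2`. -/
theorem false_of_C3 [Finite m] (h : Critical D f hf s ρ α M) (hβ : IsMinimalGap ρ α β) {p : ι}
    (hp : β p ≠ α p) (h3 : D.C3 (s p) (s p)) : False := by
  classical
  obtain ⟨Z, hDZ, hc, -, h2, h3', -⟩ := exists_le_const D
  have hgap : ∀ β, IsMinimalGap ρ α β → ∀ i j, β i ≠ α i → β j ≠ α j →
      D.C3 (s p) (s i) → D.C3 (s p) (s j) := by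
    intro β hβ i j hi hj h₁
    by_cases hij : i = j
    · exact hij ▸ h₁
    · exact h₁.trans (h3' _ _ (C3.of_iso (hDZ h₁.symm.self) (h.iso_of_gap hDZ hc hβ hij hi hj)))
  obtain ⟨q, hqp, hq⟩ := h.exists_ne hβ p
  have key : ∀ r, ¬ D.C3 (s p) (s r) → D.C2 (s p) (s r) (α r + 1) := by
    intro r hr
    have hβr : β r = α r := by
      by_contra hβr
      exact hr (hgap β hβ p r hp hβr h3)
    have hrp : p ≠ r := by rintro rfl; exact hp hβr
    have hrq : q ≠ r := by rintro rfl; exact hq hβr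
    -- Otherwise a gap `γ` below this point would contain `r` together with a coordinate of the gap
    -- `β`, and `C3` would pass from `p` through that coordinate to `r`.
    have h₀ : ρ (Function.update (Function.update (Function.update β p (α p)) q (α q)) r
        (α r + 1)) := by
      by_contra hγ
      obtain ⟨γ, hγα, hγ'⟩ := exists_isMinimalGap (α := α) (fun e => bit_add_one_ne (α r) (by
        simpa using congrFun e r)) hγ
      have hj : ∀ j, j ≠ r → γ j = α j ∨ γ j = β j := by
        intro j hjr
        rcases hγ' j with h' | h'
        · exact .inl h'
        · by_cases hjq : j = q
          · subst hjq; exact .inl (by simpa [hjr] using h')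
          by_cases hjp : j = p
          · subst hjp; exact .inl (by simpa [hjr, hjq] using h')
          exact .inr (by simpa [hjr, hjq, hjp] using h')
      have hγr : γ r ≠ α r := by
        intro hγr
        refine hγα.not_mem (hβ.between γ (fun j => ?_) hγα.ne fun e => ?_)
        · by_cases hjr : j = r
          · subst hjr; exact .inl hγr
          · exact hj j hjr
        · have e' := congrFun e p
          rcases hγ' p with h' | h'
          · exact hp (e'.symm.trans h')
          · exact hp (e'.symm.trans (by simpa [hrp, hqp.symm] using h'))
      obtain ⟨j, hjr, hjα⟩ := h.exists_ne hγα r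
      have hβj : β j ≠ α j := by
        rw [← (hj j hjr).resolve_left hjα]
        exact hjα
      exact hr (hgap γ hγα j r hjα hγr (hgap β hβ p j hp hβj h3))
    let R : ZMod 2 → ZMod 2 → ZMod 2 → Prop := fun u v w =>
      ρ (Function.update (Function.update (Function.update α p u) q v) r w) ∧
        ρ (Function.update (Function.update (Function.update β p u) q v) r w)
    have hR : Z.R3 (s p) (s q) (s r) R :=
      Z.and (slice_three hc (hDZ h.rel) α hqp.symm hrp hrq)
        (slice_three hc (hDZ h.rel) β hqp.symm hrp hrq)
    have hα' : ∀ u v, Function.update (Function.update (Function.update α p u) q v) r (α r) =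
        Function.update (Function.update α p u) q v := fun u v => by
      rw [Function.update_eq_self_iff]
      simp [hrp.symm, hrq.symm]
    have hβ' : ∀ u v, Function.update (Function.update (Function.update β p u) q v) r (α r) =
        Function.update (Function.update β p u) q v := fun u v => by
      rw [Function.update_eq_self_iff]
      simp [hrp.symm, hrq.symm, hβr]
    have h₀₀ : ¬ R (α p) (α q) (α r) := by
      simp only [R, hα']
      simp [h.not_mem]
    have h₁₁ : ¬ R (α p + 1) (α q + 1) (α r) := by
      simp only [R, hβ']
      exact fun h' => hβ.update_not_mem hp hq h'.2
    have h₁₀ : R (α p + 1) (α q) (α r) := by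
      simp only [R, hα', hβ']
      exact ⟨h.flip_mem_left hqp.symm, (hβ.update_mem hqp.symm hp hq).1⟩
    have h₀₁ : R (α p) (α q + 1) (α r) := by
      simp only [R, hα', hβ']
      exact ⟨h.flip_mem_right p q, (hβ.update_mem hqp.symm hp hq).2⟩
    have h₀' : R (α p) (α q) (α r + 1) := ⟨by simpa using h.flip_mem r, h₀⟩
    by_cases h₁ : (R (α p + 1) (α q + 1) (α r + 1) ∧ (R (α p + 1) (α q) (α r + 1) ∨
      R (α p) (α q + 1) (α r + 1))) ∨ (R (α p + 1) (α q) (α r + 1) ∧ R (α p) (α q + 1) (α r + 1))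
    · exact (h2 _ _ _ (C2.of_slice hR h₀₀ h₁₁ h₁₀ h₀₁ h₀' h₁)).resolve_right hr
    · exact absurd (h3' _ _ (C3.of_slice hc (hDZ h3) hR h₀₀ h₁₁ h₁₀ h₀₁ h₀' h₁)) hr
  by_cases hall : ∀ r, D.C3 (s p) (s r)
  · exact h.false_of_shift hall
  · push Not at hall
    obtain ⟨r₀, hr₀⟩ := hall
    exact h.false_of_C2 {j | D.C3 (s p) (s j)} (p₀ := p) h3 hr₀ fun p' hp' r hr =>
      C3.trans_C2 (C3.symm hp') (key r hr)

end Critical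

end QClone

/-! ### Critical predicates without `C3` on the gap -/

namespace QClone

variable {k : ℕ}

namespace Critical

variable {D : QClone k} {m : Type} [Nonempty m] {f : Fin k → (m → ZMod 2) → ZMod 2}
  {hf : ∀ i, Function.Surjective (f i)} {ι : Type} [Finite ι] {s : ι → Fin k}
  {ρ : (ι → ZMod 2) → Prop} {α β : ι → ZMod 2} {M : m → ι → ZMod 2}

section Pair

variable [DecidableEq ι]

/-- With an order on the sort of `p`, `ρ` would be closed under moving `p` away from `α p`. Starting
from the flip at `q`, this produces the excluded double flip. -/
theorem not_C1_of_pair (h : Critical D f hf s ρ α M) {p q : ι} (hpq : p ≠ q)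
    (hρ : ¬ ρ (Function.update (Function.update α p (α p + 1)) q (α q + 1))) :
    ¬ D.C1 (s p) := by
  intro h1
  rw [Function.update_comm hpq] at hρ
  refine hρ ?_
  rcases bit_eq_or (α p) with hp | hp
  · exact h.closed_one p (θ := fun y x => y = 0 ∨ x p = 1) (h1.atom none (some p) rfl rfl)
      (fun x => bit_eq_or _) (by simp [hp]) (h.flip_mem q) (by simp [hp])
  · exact h.closed_one p (θ := fun y x => x p = 0 ∨ y = 1) (h1.atom (some p) none rfl rfl)
      (fun x => bit_eq_or _) (by simp [hp, bit_one_add_one]) (h.flip_mem q)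
      (by simp [hp, bit_one_add_one])

theorem pair_cases (h : Critical D f hf s ρ α M) {p q r : ι} (hpq : p ≠ q) (hpr : p ≠ r)
    (hqr : q ≠ r) (hρ : ¬ ρ (Function.update (Function.update α p (α p + 1)) q (α q + 1)))
    (h3 : ¬ D.C3 (s p) (s p)) :
    (D.C5 (s p) (s q) ∧ D.C5 (s p) (s r) ∧
      ¬ ρ (Function.update (Function.update α p (α p + 1)) r (α r + 1)) ∧
      ¬ ρ (Function.update (Function.update α q (α q + 1)) r (α r + 1))) ∨
    (D.C2 (s p) (s r) (α r + 1) ∧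
      (ρ (Function.update (Function.update α p (α p + 1)) r (α r + 1)) ∨
        ρ (Function.update (Function.update α q (α q + 1)) r (α r + 1)))) := by
  obtain ⟨Z, hDZ, hc, h1, h2, -, h5⟩ := exists_le_const D
  let R : ZMod 2 → ZMod 2 → ZMod 2 → Prop := fun u v w =>
    ρ (Function.update (Function.update (Function.update α p u) q v) r w)
  have hR : Z.R3 (s p) (s q) (s r) R := slice_three hc (hDZ h.rel) α hpq hpr hqr
  have hα' : ∀ u v, Function.update (Function.update (Function.update α p u) q v) r (α r) =
      Function.update (Function.update α p u) q v := fun u v => by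
    rw [Function.update_eq_self_iff]
    simp [hpr.symm, hqr.symm]
  have hα'' : ∀ u, Function.update (Function.update α p u) q (α q) =
      Function.update α p u := fun u => by
    rw [Function.update_eq_self_iff]
    simp [hpq.symm]
  have h₀₀ : ¬ R (α p) (α q) (α r) := by
    simp only [R, hα'']
    simp [h.not_mem]
  have h₁₁ : ¬ R (α p + 1) (α q + 1) (α r) := by simpa only [R, hα'] using hρ
  have h₁₀ : R (α p + 1) (α q) (α r) := by
    simp only [R, hα']
    simpa only [hα''] using h.flip_mem p
  have h₀₁ : R (α p) (α q + 1) (α r) := by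
    simp only [R, hα']
    simpa using h.flip_mem q
  have h₀ : R (α p) (α q) (α r + 1) := by
    simp only [R, hα'']
    simpa using h.flip_mem r
  have h₁ : R (α p + 1) (α q + 1) (α r + 1) := by
    by_contra h₁
    exact (h1 _ (C1.of_slice hc hR h₀₀ h₁₁ h₁₀ h₀₁ h₀ h₁)).elim (h.not_C1_of_pair hpq hρ) h3
  have h₂ : R (α p + 1) (α q) (α r + 1) ↔
      ρ (Function.update (Function.update α p (α p + 1)) r (α r + 1)) := by
    simp only [R, hα'']
  have h₃ : R (α p) (α q + 1) (α r + 1) ↔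
      ρ (Function.update (Function.update α q (α q + 1)) r (α r + 1)) := by
    simp only [R, Function.update_eq_self]
  rw [← h₂, ← h₃]
  by_cases h₄ : R (α p + 1) (α q) (α r + 1) ∨ R (α p) (α q + 1) (α r + 1)
  · exact .inr ⟨(h2 _ _ _ (C2.of_slice hR h₀₀ h₁₁ h₁₀ h₀₁ h₀ (.inl ⟨h₁, h₄⟩))).resolve_right
      fun h' => h3 h'.self, h₄⟩
  · rw [not_or] at h₄
    obtain ⟨h₅, h₆⟩ := C5.of_slices hR h₀₀ h₁₁ h₁₀ h₀₁ h₀ h₁ h₄.1 h₄.2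
    exact .inl ⟨(h5 _ _ h₅).resolve_right fun h' => h3 h'.self,
      (h5 _ _ h₆).resolve_right fun h' => h3 h'.self, h₄.1, h₄.2⟩

end Pair

theorem false_of_parity_of_C5 [Fintype ι] (h : Critical D f hf s ρ α M) {d : ZMod 2}
    (hρ : ∀ x, ρ x ↔ ∑ p, x p = d)
    (h5 : ∀ p q r, p ≠ q → r ≠ p → r ≠ q → D.C5 (s p) (s r)) : False := by
  classical
  refine h.false_of_parity (fun p q hpq => ?_) hρ
  by_contra hne
  refine h.not_mem ((hρ α).2 ?_)
  have hsum : ∀ x : ι → ZMod 2, x p = x q → ∑ t, x t = ∑ t ∈ Finset.univ \ {p, q}, x t := by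
    intro x hx
    rw [← Finset.sum_sdiff (Finset.subset_univ {p, q}), Finset.sum_pair hne, hx,
      CharTwo.add_self_eq_zero, add_zero]
  have hsum' : ∀ x : ι → ZMod 2, ∑ t, x t = ∑ t ∈ Finset.univ \ {p, q}, x t + (x p + x q) := by
    intro x
    rw [← Finset.sum_sdiff (Finset.subset_univ {p, q}), Finset.sum_pair hne]
  by_cases hr : ∃ r, r ≠ p ∧ r ≠ q
  · obtain ⟨r, hrp, hrq⟩ := hr
    have hr' : r ∈ Finset.univ \ {p, q} := by simp [hrp, hrq]
    -- The contribution of columns `p` and `q` is moved into column `r`, so the modified rows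
    -- satisfy the equation with `p` and `q` identified. `C5` then computes the image of the new
    -- column.
    have h₁ := h.inv_of_indep_update (identify hpq h.rel) p
      (fun x b hx => by simpa [Ne.symm hne] using hx)
      (fun t => Function.update (M t) r (M t r + (M t p + M t q))) fun t => by
        beta_reduce
        rw [hρ, hsum _ (by simp [Ne.symm hne])]
        have h₂ := (hρ _).1 (h.rows t)
        rw [hsum', ← Finset.add_sum_erase _ _ hr'] at h₂
        rw [← Finset.add_sum_erase _ _ hr', ← h₂, Function.update_of_ne hrp,
          Function.update_self, add_right_comm]
        congr 1
        refine congrArg _ (Finset.sum_congr rfl fun j hj => ?_)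
        simp only [Finset.mem_erase, Finset.mem_sdiff, Finset.mem_univ, Finset.mem_insert,
          Finset.mem_singleton, not_or, true_and] at hj
        simp [hj]
    beta_reduce at h₁
    rw [hρ, hsum _ (by simp [Ne.symm hne])] at h₁
    have h₃ := R4.inv_apply (h.canon.c5 _ _ (h5 p q r hne hrp hrq)) (fun t => M t p) (fun t => M t q)
      (fun t => M t r + (M t p + M t q)) (fun t => M t r) fun t => by
        rw [add_right_comm, CharTwo.add_self_eq_zero, zero_add]
    have hq := h.image q
    rw [← hpq] at hq
    rw [h.image p, h.image r, hq] at h₃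
    rw [hsum', h₃, ← h₁, ← Finset.add_sum_erase _ _ hr', ← Finset.add_sum_erase _ _ hr',
      Function.update_of_ne hrp]
    simp only [Function.update_self]
    have h₄ : ∀ a b c : ZMod 2, a + b + (c + a) = c + b := by decide
    rw [h₄]
    congr 1
    refine Finset.sum_congr rfl fun j hj => ?_
    simp only [Finset.mem_erase, Finset.mem_sdiff, Finset.mem_univ, Finset.mem_insert,
      Finset.mem_singleton, not_or, true_and] at hj
    simp [hj, h.image]
  · push Not at hr
    have hpair : ∀ x : ι → ZMod 2, ∑ t, x t = x p + x q := fun x =>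
      Fintype.sum_eq_add p q hne fun t ht => absurd (hr t ht.1) ht.2
    have hD : D.R2 (s p) (s p) fun x y => x + y = d := by
      refine rel_congr (D.subst (s' := ![s p, s p]) (fun t => if t = p then 0 else 1)
        (fun t => ?_) h.rel) fun x => ?_
      · by_cases ht : t = p
        · simp [ht]
        · have := hr t ht
          subst this
          simp [ht, hpq]
      · rw [hρ, hpair]
        simp [Ne.symm hne]
    have hE : (inv f hf).R2 (s p) (s p) fun x y => x + y = d := by
      rcases bit_eq_or d with rfl | rfl
      · exact rel_congr ((inv f hf).eq' 0 1 rfl) fun x => CharTwo.add_eq_zero.symm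
      · exact h.canon.c4 _ hD
    have h₁ := R2.inv_apply hE (fun t => M t p) (fun t => M t q) fun t => by
      rw [← hpair]
      exact (hρ _).1 (h.rows t)
    have hq := h.image q
    rw [← hpq] at hq
    rw [h.image, hq] at h₁
    rw [hpair, h₁]

/-- Three places of difference would give `C3`, so `β` differs from `α` at `p` and `q` only. By
`pair_cases`, each other coordinate is linked to these by `C5` or separated from them by `C2`:
either all are linked and `ρ` is linear, or `false_of_C2` applies. -/
theorem false_of_not_C3 (h : Critical D f hf s ρ α M) (hβ : IsMinimalGap ρ α β)
    (h3 : ∀ p, β p ≠ α p → ¬ D.C3 (s p) (s p)) : False := by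
  classical
  have := Fintype.ofFinite ι
  obtain ⟨p, hp⟩ := Function.ne_iff.1 hβ.ne
  obtain ⟨q, hqp, hq⟩ := h.exists_ne hβ p
  have hpq := hqp.symm
  have hρ : ¬ ρ (Function.update (Function.update α p (α p + 1)) q (α q + 1)) := by
    convert hβ.not_mem using 2
    funext r
    by_cases hrq : r = q
    · subst hrq; simp [bit_eq_add_one hq]
    by_cases hrp : r = p
    · subst hrp; simp [hrq, bit_eq_add_one hp]
    by_cases hr : β r = α r
    · simp [hrq, hrp, hr]
    · exact absurd (h.C3_of_three hβ hpq (Ne.symm hrp) (Ne.symm hrq) hp hq hr) (h3 p hp)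
  have hρ' : ¬ ρ (Function.update (Function.update α q (α q + 1)) p (α p + 1)) := by
    rwa [Function.update_comm hqp]
  let N : ι → Prop := fun r => ¬ ρ (Function.update (Function.update α p (α p + 1)) r (α r + 1)) ∧
    ¬ ρ (Function.update (Function.update α q (α q + 1)) r (α r + 1))
  have hN : ∀ r, r ≠ p → r ≠ q → N r → D.C5 (s p) (s q) ∧ D.C5 (s p) (s r) := by
    intro r hrp hrq hr
    rcases h.pair_cases hpq hrp.symm hrq.symm hρ (h3 p hp) with h' | h'
    · exact ⟨h'.1, h'.2.1⟩
    · exact (h'.2.elim hr.1 hr.2).elim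
  by_cases hall : ∀ r, r ≠ p → r ≠ q → N r
  · have h5 : ∀ r₀, r₀ ≠ p → r₀ ≠ q → ∀ r, D.C5 (s p) (s r) := by
      intro r₀ hp₀ hq₀ r
      have h₁ := hN r₀ hp₀ hq₀ (hall r₀ hp₀ hq₀)
      by_cases hrp : r = p
      · rw [hrp]
        exact h₁.1.trans h₁.1.symm
      by_cases hrq : r = q
      · rw [hrq]
        exact h₁.1
      exact (hN r hrp hrq (hall r hrp hrq)).2
    have hclosed : ∀ r, r ≠ p → ∀ x, ρ x →
        ρ (Function.update (Function.update x p (x p + 1)) r (x r + 1)) := by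
      intro r hrp x hx
      by_cases hr₀ : ∃ r₀, r₀ ≠ p ∧ r₀ ≠ q
      · obtain ⟨r₀, hr₀, hr₁⟩ := hr₀
        refine h.closed_of_C5 hrp.symm (h5 r₀ hr₀ hr₁ r) ?_ x hx
        by_cases hrq : r = q
        · rwa [hrq]
        · exact (hall r hrp hrq).1
      -- With only two coordinates there is no third one to supply `C5`, but all four points are
      -- known.
      · push Not at hr₀
        have := hr₀ r hrp
        subst this
        have hx' : ∀ y : ι → ZMod 2, y = Function.update (Function.update α p (y p)) r (y r) := by
          intro y
          funext t
          by_cases htr : t = r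
          · subst htr; simp
          by_cases htp : t = p
          · subst htp; simp [htr]
          exact absurd (hr₀ t htp) htr
        rw [hx' (Function.update _ _ _)]
        rw [hx' x] at hx
        simp only [Function.update_self, Function.update_of_ne hpq]
        rcases eq_or_ne (x p) (α p) with h₁ | h₁ <;> rcases eq_or_ne (x r) (α r) with h₂ | h₂
        · rw [h₁, h₂] at hx
          exact absurd hx (by simp [h.not_mem])
        · rw [h₁, bit_eq_add_one h₂, add_assoc, CharTwo.add_self_eq_zero, add_zero]
          exact h.flip_mem_left hpq
        · rw [h₂, bit_eq_add_one h₁, add_assoc, CharTwo.add_self_eq_zero, add_zero]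
          exact h.flip_mem_right p r
        · rw [bit_eq_add_one h₁, bit_eq_add_one h₂] at hx
          exact absurd hx hρ
    have hff : ∀ (x : ι → ZMod 2) (t : ι), Function.update (Function.update x t (x t + 1)) t
        (Function.update x t (x t + 1) t + 1) = x := fun x t => by
      rw [Function.update_idem, Function.update_eq_self_iff, Function.update_self, add_assoc,
        CharTwo.add_self_eq_zero, add_zero]
    have hiff : ∀ r, r ≠ p → ∀ x, ρ (Function.update x r (x r + 1)) ↔
        ρ (Function.update x p (x p + 1)) := by
      intro r hrp x
      constructor <;> intro hx
      · have := hclosed r hrp _ hx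
        rw [Function.update_comm hrp.symm, hff] at this
        simpa [hrp.symm] using this
      · have := hclosed r hrp _ hx
        rw [hff] at this
        simpa [hrp] using this
    -- Carrying along the flip at `p` makes the claim invariant under every flip: any flip acts on
    -- membership as the flip at `p` does.
    have hmain : ∀ x, (ρ x ↔ ∑ t, x t = ∑ t, α t + 1) ∧
        (ρ (Function.update x p (x p + 1)) ↔ ∑ t, x t + 1 = ∑ t, α t + 1) := by
      refine of_flip_closed (fun r x hx => ?_) (x := α) ?_
      · rw [sum_update_add_one, add_assoc, CharTwo.add_self_eq_zero, add_zero]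
        by_cases hrp : r = p
        · subst hrp
          rw [hff]
          exact hx.symm
        · rw [hiff r hrp, ← hiff r hrp (Function.update _ _ _), hff]
          exact hx.symm
      · exact ⟨iff_of_false h.not_mem (bit_add_one_ne _).symm, iff_of_true (h.flip_mem p) rfl⟩
    refine h.false_of_parity_of_C5 (fun x => (hmain x).1) fun p' q' r hpq' hrp hrq => ?_
    obtain ⟨r₀, hp₀, hq₀⟩ : ∃ r₀, r₀ ≠ p ∧ r₀ ≠ q := by
      by_contra hcon
      push Not at hcon
      have h₂ : ∀ t, t = p ∨ t = q := fun t => or_iff_not_imp_left.2 (hcon t)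
      rcases h₂ p' with e | e <;> rcases h₂ q' with e' | e' <;> rcases h₂ r with e'' | e'' <;>
        first
        | exact hpq' (e.trans e'.symm)
        | exact hrp (e''.trans e.symm)
        | exact hrq (e''.trans e'.symm)
    exact (h5 r₀ hp₀ hq₀ p').symm.trans (h5 r₀ hp₀ hq₀ r)
  · push Not at hall
    obtain ⟨r₀, hr₀p, hr₀q, hr₀⟩ := hall
    have hC : ∀ r, r ≠ p → r ≠ q → ¬ N r →
        D.C2 (s p) (s r) (α r + 1) ∧ D.C2 (s q) (s r) (α r + 1) := by
      intro r hrp hrq hr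
      constructor
      · rcases h.pair_cases hpq hrp.symm hrq.symm hρ (h3 p hp) with h' | h'
        · exact absurd h'.2.2 hr
        · exact h'.1
      · rcases h.pair_cases hqp hrq.symm hrp.symm hρ' (h3 q hq) with h' | h'
        · exact absurd ⟨h'.2.2.2, h'.2.2.1⟩ hr
        · exact h'.1
    refine h.false_of_C2 {r | r = p ∨ r = q ∨ N r} (p₀ := p) (r₀ := r₀) (.inl rfl)
      (by simp [hr₀p, hr₀q, hr₀]) fun p' hp' r hr => ?_
    simp only [Set.mem_ofPred_eq, not_or] at hp' hr
    by_cases h₁ : p' = p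
    · rw [h₁]
      exact (hC r hr.1 hr.2.1 hr.2.2).1
    by_cases h₂ : p' = q
    · rw [h₂]
      exact (hC r hr.1 hr.2.1 hr.2.2).2
    exact C5.trans_C2 (hN p' h₁ h₂ ((hp'.resolve_left h₁).resolve_left h₂)).2
      (hC r hr.1 hr.2.1 hr.2.2).1

theorem false [Finite m] (h : Critical D f hf s ρ α M) : False := by
  by_cases hρ : ∀ x, x ≠ α → ρ x
  · exact h.false_of_forall_ne hρ
  push Not at hρ
  obtain ⟨γ, hγ, hγρ⟩ := hρ
  obtain ⟨β, hβ, -⟩ := exists_isMinimalGap hγ hγρ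
  by_cases h3 : ∃ p, β p ≠ α p ∧ D.C3 (s p) (s p)
  · obtain ⟨p, hp, h3⟩ := h3
    exact h.false_of_C3 hβ hp h3
  · push Not at h3
    exact h.false_of_not_C3 hβ h3

end Critical

/-- Surjective operations that preserve the canonical predicates of `D` preserve all the predicates
of `D`. -/
theorem le_inv_of_canonLE {D : QClone k} {m : Type} [Finite m] [Nonempty m]
    {f : Fin k → (m → ZMod 2) → ZMod 2} {hf : ∀ i, Function.Surjective (f i)}
    (h : CanonLE D (inv f hf)) : D ≤ inv f hf := by
  intro ι _ s P hP
  induction hn : Nat.card ι using Nat.strong_induction_on generalizing ι with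
  | _ n ih =>
  intro M hM
  by_contra hα
  set α : ι → ZMod 2 := fun p => f (s p) fun t => M t p
  let T : Set ((ι → ZMod 2) → Prop) := {σ | D.rel s σ ∧ (∀ x, P x → σ x) ∧ ¬ σ α}
  obtain ⟨ρ, -, hρ⟩ := (Set.toFinite T).exists_le_maximal (a := P) ⟨hP, fun _ => id, hα⟩
  obtain ⟨⟨h₁, h₂, h₃⟩, h₄⟩ := hρ
  refine Critical.false (D := D) (f := f) (hf := hf) (s := s) (ρ := ρ) (α := α) (M := M)
    ⟨h₁, fun t => h₂ _ (hM t), fun _ => rfl, h₃, fun σ hσ hρσ hσα => ?_, ?_, h⟩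
  · exact h₄ ⟨hσ, fun x hx => hρσ x (h₂ x hx), hσα⟩ hρσ
  · intro κ _ s' Q hκ hQ
    exact ih _ (hn ▸ hκ) hQ rfl

end QClone

/-! ### Finiteness of the canonical relations of the first six types -/

section Finite

open Canonical

variable {k : ℕ}

theorem SortedRel.finite_arity_lt (A : Type) [Finite A] (k N : ℕ) :
    {ρ : SortedRel A k | ρ.arity < N}.Finite := by
  refine (Set.finite_range fun p : Σ n : Fin N, (Fin n → Fin k) × Set (Fin n → A) =>
    (⟨p.1, p.2.1, p.2.2⟩ : SortedRel A k)).subset fun ρ hρ => ?_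
  exact ⟨⟨⟨ρ.arity, hρ⟩, ρ.sort, ρ.carrier⟩, rfl⟩

theorem Canonical.oneSix_finite (k : ℕ) : (oneSix k).Finite := by
  refine (SortedRel.finite_arity_lt (ZMod 2) k (k + 5)).subset ?_
  rintro ρ ⟨σ, hσ, e, -⟩
  have he : σ.arity = ρ.arity := by simpa using Fintype.card_congr e
  have hσ' : σ.arity < k + 5 := by
    cases hσ with
    | c6 hn s hs b =>
      have := Fintype.card_le_of_injective s hs
      simp only [Fintype.card_fin] at this
      exact Nat.lt_of_le_of_lt this (by lia)
    | _ => simp [c1, c2, c3, c3', c4, c5]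
  exact Nat.lt_of_le_of_lt he.ge hσ'

theorem SortedRel.Similar.refl {A : Type} (ρ : SortedRel A k) : ρ.Similar ρ :=
  ⟨Equiv.refl _, fun _ => rfl, fun _ => Iff.rfl⟩

theorem Canonical.IsBasicOneSix.mem_oneSix {ρ : SortedRel (ZMod 2) k} (h : IsBasicOneSix ρ) :
    ρ ∈ oneSix k :=
  ⟨ρ, h, .refl ρ⟩

end Finite

/-! ### Downsets of tuples and the comparison of clones -/

namespace QClone

open Canonical

variable {k : ℕ}

/-- A disjunction of equations defines every disjunction with a smaller tuple. -/
theorem rel_of_tuple_le {D : QClone k} {n n' : ℕ} {t : Fin n → Fin k} {t' : Fin n' → Fin k}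
    {b b' : Fin k → ZMod 2} (hle : tuple t b ≤ tuple t' b')
    (h : D.rel t' fun x => ∃ p, x p = b' (t' p)) : D.rel t fun x => ∃ p, x p = b (t p) := by
  classical
  have hemb : ∀ q : Fin k × ZMod 2, Nonempty ({p // t p = q.1 ∧ b (t p) = q.2} ↪
      {p // t' p = q.1 ∧ b' (t' p) = q.2}) := fun q =>
    Function.Embedding.nonempty_of_card_le (by
      rw [Fintype.card_subtype, Fintype.card_subtype]
      exact hle q)
  let F := fun q => (hemb q).some
  let v : Fin n → Fin n' := fun p => F (t p, b (t p)) ⟨p, rfl, rfl⟩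
  have hv₁ : ∀ p, t' (v p) = t p := fun p => (F (t p, b (t p)) ⟨p, rfl, rfl⟩).2.1
  have hv₂ : ∀ p, b' (t' (v p)) = b (t p) := fun p => (F (t p, b (t p)) ⟨p, rfl, rfl⟩).2.2
  have hv : Function.Injective v := by
    intro p p' hpp
    have h₁ : t p = t p' := by rw [← hv₁, hpp, hv₁]
    have h₂ : b (t p) = b (t p') := by rw [h₁]
    have key : ∀ q q' (z : {p // t p = q.1 ∧ b (t p) = q.2})
        (z' : {p // t p = q'.1 ∧ b (t p) = q'.2}), q = q' → (F q z).1 = (F q' z').1 →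
        z.1 = z'.1 := by
      rintro q _ z z' rfl h
      exact congrArg _ ((F q).injective (Subtype.ext h))
    exact key _ _ ⟨p, rfl, rfl⟩ ⟨p', rfl, rfl⟩ (Prod.ext h₁ h₂) hpp
  -- Variables in the image of `v` become free variables; the surplus ones go to the right summand,
  -- where they are quantified universally.
  let w : Fin n' → Fin n ⊕ Fin n' := fun p' =>
    if hp : ∃ p, v p = p' then .inl hp.choose else .inr p'
  have hw : ∀ p, w (v p) = .inl p := fun p => by
    have hp : ∃ q, v q = v p := ⟨p, rfl⟩
    simp only [w, dif_pos hp]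
    exact congrArg _ (hv hp.choose_spec)
  have hw' : ∀ p', (∀ p, v p ≠ p') → w p' = .inr p' := fun p' hp' => by
    have hp : ¬ ∃ p, v p = p' := by simpa using hp'
    simp only [w, dif_neg hp]
  refine rel_congr (all_sum t' (Q := fun x y => ∃ p', Sum.elim x y (w p') = b' (t' p')) ?_)
    fun x => ?_
  · refine rel_congr (D.subst (s' := Sum.elim t t') w (fun p' => ?_) h) fun z => ?_
    · by_cases hp : ∃ p, v p = p'
      · obtain ⟨p, rfl⟩ := hp
        rw [hw, hv₁]
        rfl
      · rw [hw' p' (by simpa using hp)]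
        rfl
    · refine exists_congr fun p' => ?_
      beta_reduce
      rcases w p' with p | p <;> rfl
  · constructor
    · intro hx
      -- These values falsify every surplus equation, so a remaining equation must hold.
      obtain ⟨p', hp'⟩ := hx fun p' => b' (t' p') + 1
      by_cases hp : ∃ p, v p = p'
      · obtain ⟨p, rfl⟩ := hp
        exact ⟨p, by rw [← hv₂, ← hp', hw]; rfl⟩
      · rw [hw' p' (by simpa using hp)] at hp'
        exact absurd hp' (bit_add_one_ne _)
    · rintro ⟨p, hp⟩ y
      exact ⟨v p, by rw [hw, hv₂]; exact hp⟩

end QClone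

section Tuples

open Canonical

variable {k : ℕ}

/-- A tuple of this form vanishes at `(i, c)` for `c ≠ b i`, hence so does `m`; taking `m (i, b i)`
variables of each sort `i` realizes it. -/
theorem Canonical.exists_tuple_eq {n' : ℕ} {t' : Fin n' → Fin k} {b : Fin k → ZMod 2}
    {m : Fin k × ZMod 2 → ℕ} (h : m ≤ tuple t' b) :
    ∃ (n : ℕ) (t : Fin n → Fin k), m = tuple t b := by
  classical
  let e := Fintype.equivFin (Σ i, Fin (m (i, b i)))
  refine ⟨_, fun p => (e.symm p).1, funext fun ⟨i, c⟩ => ?_⟩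
  by_cases hc : b i = c
  · subst hc
    have h₁ := Fintype.card_congr ((e.symm.subtypeEquiv (p := fun p => (e.symm p).1 = i)
      (q := fun z => z.1 = i) fun _ => Iff.rfl).trans (Equiv.sigmaSubtype i))
    rw [Fintype.card_subtype, Fintype.card_fin] at h₁
    rw [← h₁, tuple]
    refine congrArg _ (Finset.filter_congr fun p _ => ?_)
    exact ⟨fun h => ⟨h, congrArg b h⟩, fun h => h.1⟩
  · have h₀ : ∀ {l : ℕ} (s : Fin l → Fin k), tuple s b (i, c) = 0 := fun s =>
      Finset.card_eq_zero.2 (Finset.filter_eq_empty_iff.2 fun p _ hp =>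
        hc ((congrArg b hp.1.symm).trans hp.2))
    rw [h₀, ← Nat.le_zero, ← h₀ t']
    exact h (i, c)

theorem qppClosure_c7_of_tuple_le (hk : 1 ≤ k) {T : Set (SortedRel (ZMod 2) k)}
    (hT : qppClosure T = T) {n n' : ℕ} {t : Fin n → Fin k} {t' : Fin n' → Fin k}
    {b b' : Fin k → ZMod 2} (hle : tuple t b ≤ tuple t' b') (h : c7 t' b' ∈ T) : c7 t b ∈ T := by
  rw [← hT] at h ⊢
  exact (QClone.gen_rel_fin_iff hk _ _).1
    (QClone.rel_of_tuple_le hle ((QClone.gen_rel_fin_iff hk _ _).2 h))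

theorem isLowerSet_tuples (hk : 1 ≤ k) {T : Set (SortedRel (ZMod 2) k)}
    (hT : qppClosure T = T) : IsLowerSet (tuples T) := by
  rintro _ m hm ⟨n', t', b, h, rfl⟩
  obtain ⟨n, t, rfl⟩ := exists_tuple_eq hm
  exact ⟨n, t, b, qppClosure_c7_of_tuple_le hk hT hm h, rfl⟩

/-- A quantified relational clone is determined by its canonical relations. -/
theorem subset_of_canonical (hk : 1 ≤ k) {S T : Set (SortedRel (ZMod 2) k)}
    (hS : qppClosure S = S) (hT : qppClosure T = T) (h : ∀ ρ ∈ oneSix k, ρ ∈ S → ρ ∈ T)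
    (h7 : tuples S ⊆ tuples T) : S ⊆ T := by
  intro ρ hρ
  rw [← hS, ← QClone.gen_rel_iff hk] at hρ
  rw [← hT, ← QClone.gen_rel_iff hk]
  refine QClone.rel_of_forall_inv fun m _ _ f hf hle => ?_
  have key : ∀ {n : ℕ} (s : Fin n → Fin k) (P : (Fin n → ZMod 2) → Prop),
      IsBasicOneSix ⟨n, s, {x | P x}⟩ → (QClone.gen hk S).rel s P →
        (QClone.inv f hf).rel s P := by
    intro n s P hP h₁
    rw [QClone.gen_rel_fin_iff, hS] at h₁
    have h₂ := h _ hP.mem_oneSix h₁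
    rw [← hT, ← QClone.gen_rel_fin_iff hk] at h₂
    exact hle h₂
  refine QClone.le_inv_of_canonLE (D := QClone.gen hk S) ⟨fun i => key _ _ (.c1 i),
    fun i j b => key _ _ (.c2 i j b), fun i j h₃ => ?_, fun i => key _ _ (.c4 i),
    fun i j => key _ _ (.c5 i j), fun n s b hn hs => key _ _ (.c6 hn s hs b),
    fun n s b h₇ => ?_⟩ hρ
  · by_cases hij : i = j
    · subst hij
      exact QClone.C3.of_three (key _ _ (.c3' i) (QClone.C3.three h₃))
    · exact key _ _ (.c3 i j hij) h₃
  · rw [QClone.gen_rel_fin_iff, hS] at h₇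
    -- The tuple fixes the disjunction only up to the order of variables and the values of `b` at
    -- absent sorts, so the comparison lemma is used even though the tuples are equal.
    obtain ⟨n', t', b', h₈, heq⟩ := h7 ⟨n, s, b, h₇, rfl⟩
    have h₉ := qppClosure_c7_of_tuple_le hk hT heq.le h₈
    rw [← hT] at h₉
    exact hle ((QClone.gen_rel_fin_iff hk _ _).2 h₉)

end Tuples

theorem mainTheorem5 (k : ℕ) (hk : 1 ≤ k) :
    (Canonical.oneSix k).Finite ∧
    ∃ ν : QuantRelClone k ↪o
        Set ↥(Canonical.oneSix k) × LowerSet (Fin k × ZMod 2 → ℕ),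
      ∀ S : QuantRelClone k,
        (∀ ρ : ↥(Canonical.oneSix k), ρ ∈ (ν S).1 ↔ ρ.val ∈ S.val) ∧
        (∀ m : Fin k × ZMod 2 → ℕ, m ∈ (ν S).2 ↔ m ∈ Canonical.tuples S.val) := by
  refine ⟨Canonical.oneSix_finite k, OrderEmbedding.ofMapLEIff
    (fun S => ({ρ | ρ.val ∈ S.val}, ⟨Canonical.tuples S.val, isLowerSet_tuples hk S.2⟩))
    fun S T => ⟨fun h => ?_, fun h => ⟨fun ρ hρ => h hρ, ?_⟩⟩,
    fun S => ⟨fun ρ => Iff.rfl, fun m => Iff.rfl⟩⟩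
  · exact subset_of_canonical hk S.2 T.2 (fun ρ hρ hS => h.1 (show ⟨ρ, hρ⟩ ∈ _ from hS)) h.2
  · rintro _ ⟨n, t, b, hb, rfl⟩
    exact ⟨n, t, b, h hb, rfl⟩
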